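/- Let $\Bbbk$ be an algebraically closed field of arbitrary characteristic and let $M$ be a free abelian group of rank $n$, with torus $T_M=\operatorname{Spec}\Bbbk[M]$. For a finite subset $A=\{u_0,\dots,u_N\}\subset M$ (with $u_0,\dots,u_N$ distinct), let $X_A\subset\mathbb P^N$ be the closure of the image of $\varphi_A:T_M\to\mathbb P^N$, $t\mapsto[z^{u_0}(t):\cdots:z^{u_N}(t)]$; the coordinates of $\mathbb P^N=\mathbb P^{\#A-1}$ are indexed by the elements of $A$. For a subset $S\subset M$, $\langle S-S\rangle$ denotes the subgroup generated by the differences of elements of $S$, and for a finite nonempty $S$ the torus $T_{\langle S-S\rangle}$ is the open dense orbit of $X_S$ via $t\mapsto[z^{b-b_0}(t)]_{b\in S}$ (for any fixed $b_0\in S$). Two subvarieties $X_i\subset\mathbb P^{N_i}$, $i=1,2$, are projectively equivalent if there are linear embeddings $\jmath_i:\mathbb P^{N_i}\hookrightarrow\mathbb P^{L}$ with $\jmath_1(X_1)=\jmath_2(X_2)$. The Gauss map $\gamma:X\dashrightarrow\mathbb G(n,\mathbb P^N)$ of an $n$-dimensional projective variety $X\subset\mathbb P^N$ sends each smooth point to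 the embedded tangent space there, and the Gauss defect $\delta_\gamma(X)$ is the dimension of a general fiber of $\gamma$. Assume that $A$ spans the affine lattice $M$, i.e. every element of $M$ is of the form $\sum_i a_iu_i$ with $a_i\in\mathbb Z$ and $\sum_i a_i=1$. (Then $\varphi_A$ identifies $T_M$ with a dense open subset of $X_A$ which consists of smooth points, and $\dim X_A=n$.) Set $$B:=\{u_{i_0}+\cdots+u_{i_n}\mid u_{i_0},\dots,u_{i_n}\in A\text{ span the }\Bbbk\text{-affine space }M_\Bbbk=M\otimes_{\mathbb Z}\Bbbk\},$$ and let $\pi:M\to M':=M/(\langle B-B\rangle_{\mathbb R}\cap M)$ be the natural projection, where $\langle B-B\rangle_{\mathbb R}$ is the real subspace of $M\otimes_{\mathbb Z}\mathbb R$ spanned by $B-B$. Let $\gamma:X_A\dashrightarrow\mathbb G(n,\mathbb P^N)$ be the Gauss map of $X_A$. Then $B$ is nonempty and the following hold. 1. The closure $\overline{\gamma(X_A)}$ of the image of $\gamma$, embedded in a projective space by the Plücker embedding of $\mathbb G(n,\mathbb P^N)$, is projectively equivalent to the toric variety $X_B$. 2. Under the identification $\overline{\gamma(X_A)}\cong X_B$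 given by such a projective equivalence, the restriction of $\gamma$ to $T_M\subset X_A$ is the surjective morphism $T_M\twoheadrightarrow T_{\langle B-B\rangle}\subset X_B$ induced by the inclusion $\langle B-B\rangle\subset M$. 3. Let $F\subset T_M$ be an irreducible component, with the reduced structure, of any fiber of $\gamma|_{T_M}$, and let $T_{M'}\hookrightarrow T_M$ be the subtorus induced by $\pi$. Then $F$ is a translate of $T_{M'}$ by an element of $T_M$, and the closure $\overline F\subset X_A$ is projectively equivalent to the toric variety $X_{\pi(A)}$. In particular, $\delta_\gamma(X_A)=\operatorname{rank}M'=n-\operatorname{rank}\langle B-B\rangle$. -/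

import Mathlib

open scoped LinearAlgebra.Projectivization TensorProduct Pointwise

namespace ToricGauss

noncomputable section

/-! ### Projective space over a field, with its Zariski topology -/

/-- The Zariski topology on the projective space with homogeneous coordinates indexed by `ι`:
the principal open sets `{f ≠ 0}`, `f` a homogeneous polynomial, form a basis. -/
instance zariskiProj (k : Type*) [Field k] (ι : Type*) : TopologicalSpace (ℙ k (ι → k)) :=
  TopologicalSpace.generateFrom
    {U | ∃ (d : ℕ) (f : MvPolynomial ι k), f.IsHomogeneous d ∧
      U = {x | MvPolynomial.eval x.rep f ≠ 0}}

/-- Two subsets of projective spaces are projectively equivalent if some linear embeddings of the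
two ambient spaces into a common projective space carry them to the same set. A term of this type
is such a pair of embeddings. -/
structure ProjectiveEquivalence {k : Type*} [Field k] {ι κ : Type*}
    (X : Set (ℙ k (ι → k))) (Y : Set (ℙ k (κ → k))) where
  dim : ℕ
  left : (ι → k) →ₗ[k] (Fin (dim + 1) → k)
  right : (κ → k) →ₗ[k] (Fin (dim + 1) → k)
  left_injective : Function.Injective left
  right_injective : Function.Injective right
  image_eq : Projectivization.map left left_injective '' X =
    Projectivization.map right right_injective '' Y

def ProjectivelyEquivalent {k : Type*} [Field k] {ι κ : Type*}
    (X : Set (ℙ k (ι → k))) (Y : Set (ℙ k (κ → k))) : Prop :=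
  Nonempty (ProjectiveEquivalence X Y)

/-! ### Grassmannians and the Plücker embedding -/

/-- The Grassmannian `𝔾(n, ℙ^N)` of `n`-planes in `ℙ^N`, i.e. of `(n+1)`-dimensional linear
subspaces of `k^(N+1)`. -/
def Grassmannian (k : Type*) [Field k] (n N : ℕ) : Type _ :=
  {W : Submodule k (Fin (N + 1) → k) // Module.finrank k W = n + 1}

/-- The maximal minors of the matrix with rows `v 0, …, v n`. -/
def pluckerVector {k : Type*} [Field k] {n N : ℕ} (v : Fin (n + 1) → Fin (N + 1) → k) :
    (Fin (n + 1) ↪o Fin (N + 1)) → k :=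
  fun I => Matrix.det (Matrix.of fun a b => v a (I b))

theorem pluckerVector_ne_zero {k : Type*} [Field k] {n N : ℕ}
    {v : Fin (n + 1) → Fin (N + 1) → k} (hv : LinearIndependent k v) :
    pluckerVector v ≠ 0 := by
  intro h0
  have hinj : Function.Injective (Matrix.vecMulLinear (Matrix.of v)) :=
    Matrix.vecMul_injective_iff.2 (show LinearIndependent k (Matrix.of v).row from hv)
  obtain ⟨g, hg⟩ := LinearMap.exists_leftInverse_of_injective _ (LinearMap.ker_eq_bot.2 hinj)
  -- a right inverse `w` of the matrix with rows `v`
  let w : Matrix (Fin (N + 1)) (Fin (n + 1)) k := Matrix.of fun i => g (Pi.single i 1)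
  have hw : Matrix.of v * w = 1 := by
    ext a b
    have h1 := congrFun (LinearMap.congr_fun hg (Pi.single a 1)) b
    simp only [LinearMap.comp_apply, LinearMap.id_apply, Matrix.vecMulLinear_apply,
      Matrix.single_one_vecMul] at h1
    rw [Matrix.one_eq_pi_single, ← h1, Matrix.row, show (Matrix.of v) a = v a from rfl]
    conv_rhs => rw [pi_eq_sum_univ' (v a)]
    simp [w, Matrix.mul_apply]
  have hdet : ∑ p : Fin (n + 1) → Fin (N + 1),
      (Matrix.of fun a b => v a (p b)).det * ∏ i, w (p i) i = 1 := by
    rw [← Matrix.det_one (n := Fin (n + 1)) (R := k), ← hw]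
    simp only [Matrix.det_apply', Matrix.mul_apply, Finset.prod_univ_sum, Finset.mul_sum,
      Fintype.piFinset_univ, Finset.sum_mul]
    rw [Finset.sum_comm]
    simp [Finset.prod_mul_distrib, mul_assoc]
  refine one_ne_zero (hdet.symm.trans (Finset.sum_eq_zero fun p _ => ?_))
  rw [mul_eq_zero]
  left
  by_cases hp : Function.Injective p
  · have hs : StrictMono (p ∘ Tuple.sort p) :=
      (Tuple.monotone_sort p).strictMono_of_injective (hp.comp (Tuple.sort p).injective)
    have h2 := congrFun h0 (OrderEmbedding.ofStrictMono _ hs)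
    have h3 := Matrix.det_permute' (Tuple.sort p) (Matrix.of fun a b => v a (p b))
    rw [show (Matrix.of fun a b => v a (p b)).submatrix id (Tuple.sort p) =
      Matrix.of fun a b => v a ((OrderEmbedding.ofStrictMono _ hs) b) from rfl] at h3
    rw [pluckerVector, Pi.zero_apply, h3] at h2
    refine (mul_eq_zero.1 h2).resolve_left ?_
    rcases Int.units_eq_one_or (Equiv.Perm.sign (Tuple.sort p)) with h | h <;> simp [h]
  · simp only [Function.Injective, not_forall] at hp
    obtain ⟨a, b, hab, hne⟩ := hp
    exact Matrix.det_zero_of_column_eq hne fun c => by simp [hab]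

/-- The rows: a basis of the linear subspace `W`. -/
def Grassmannian.basis {k : Type*} [Field k] {n N : ℕ} (W : Grassmannian k n N) :
    Module.Basis (Fin (n + 1)) k W.1 :=
  Module.finBasisOfFinrankEq k W.1 W.2

/-- The Plücker embedding of `𝔾(n, ℙ^N)`, in the Plücker coordinates indexed by
`i₀ < ⋯ < iₙ`. (Another basis of `W` multiplies all of them by one nonzero scalar.) -/
def plucker {k : Type*} [Field k] {n N : ℕ} (W : Grassmannian k n N) :
    ℙ k ((Fin (n + 1) ↪o Fin (N + 1)) → k) :=
  Projectivization.mk k (pluckerVector fun a => (W.basis a : Fin (N + 1) → k))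
    (pluckerVector_ne_zero
      (W.basis.linearIndependent.map' W.1.subtype (Submodule.ker_subtype _)))

/-! ### Smooth points and the Gauss map -/

/-- The linear subspace of `k^(N+1)` whose projectivization is the embedded tangent space of `X`
at `x`: it is cut out by the differentials at `x` of the homogeneous polynomials that vanish
on `X`. -/
def embeddedTangentSpace {k : Type*} [Field k] {N : ℕ} (X : Set (ℙ k (Fin (N + 1) → k)))
    (x : ℙ k (Fin (N + 1) → k)) : Submodule k (Fin (N + 1) → k) where
  carrier := {v | ∀ (d : ℕ) (f : MvPolynomial (Fin (N + 1)) k), f.IsHomogeneous d →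
    (∀ y ∈ X, MvPolynomial.eval y.rep f = 0) →
    ∑ i, MvPolynomial.eval x.rep (MvPolynomial.pderiv i f) * v i = 0}
  add_mem' {v w} hv hw d f hf hX := by
    simp only [Pi.add_apply, mul_add, Finset.sum_add_distrib, hv d f hf hX, hw d f hf hX, add_zero]
  zero_mem' d f hf hX := by simp
  smul_mem' c v hv d f hf hX := by
    have h : ∑ i, MvPolynomial.eval x.rep (MvPolynomial.pderiv i f) * (c • v) i =
        c * ∑ i, MvPolynomial.eval x.rep (MvPolynomial.pderiv i f) * v i := by
      rw [Finset.mul_sum]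
      exact Finset.sum_congr rfl fun i _ => by simp only [Pi.smul_apply, smul_eq_mul]; ring
    rw [h, hv d f hf hX, mul_zero]

/-- The smooth points of a projective variety `X`: the points at which the embedded tangent
space has (projective) dimension `dim X`. -/
def smoothLocus {k : Type*} [Field k] {N : ℕ} (X : Set (ℙ k (Fin (N + 1) → k))) :
    Set (ℙ k (Fin (N + 1) → k)) :=
  {x | x ∈ X ∧ (Module.finrank k (embeddedTangentSpace X x) : WithBot ℕ∞) =
    topologicalKrullDim X + 1}

/-- The Gauss map of an `n`-dimensional projective variety `X ⊆ ℙ^N`, which sends a smooth point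
to the embedded tangent space there. -/
def gaussMap {k : Type*} [Field k] {N : ℕ} (X : Set (ℙ k (Fin (N + 1) → k))) {n : ℕ}
    (hX : topologicalKrullDim X = n) (x : smoothLocus X) : Grassmannian k n N :=
  ⟨embeddedTangentSpace X x.1, by have h := x.2.2; rw [hX] at h; exact_mod_cast h⟩

/-- The closure of the image of the Gauss map, inside the Plücker space. -/
def gaussImage {k : Type*} [Field k] {N : ℕ} (X : Set (ℙ k (Fin (N + 1) → k))) {n : ℕ}
    (hX : topologicalKrullDim X = n) : Set (ℙ k ((Fin (n + 1) ↪o Fin (N + 1)) → k)) :=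
  closure (Set.range fun x : smoothLocus X => plucker (gaussMap X hX x))

/-- `δ` is the dimension of a general fiber of the Gauss map of `X`: for all points `x` of
some dense open subset of `X`, `x` is smooth and the fiber through `x` has dimension `δ`. -/
def IsGaussDefect {k : Type*} [Field k] {N : ℕ} (X : Set (ℙ k (Fin (N + 1) → k))) {n : ℕ}
    (hX : topologicalKrullDim X = n) (δ : ℕ) : Prop :=
  ∃ U : Set (ℙ k (Fin (N + 1) → k)), IsOpen U ∧ X ⊆ closure (X ∩ U) ∧
    ∀ x ∈ X ∩ U, ∃ hx : x ∈ smoothLocus X,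
      topologicalKrullDim {y : smoothLocus X | gaussMap X hX y = gaussMap X hX ⟨x, hx⟩} = δ

/-! ### Tori and toric varieties -/

/-- The torus `T_M = Spec k[M]`, through its `k`-points: the characters `M → kˣ`. It is a group
under pointwise multiplication. -/
abbrev Torus (k M : Type*) [Field k] [AddCommGroup M] : Type _ := Multiplicative M →* kˣ

/-- The monomial `z^u` as a function on `T_M`. -/
def Torus.monomial {k M : Type*} [Field k] [AddCommGroup M] (u : M) (t : Torus k M) : k :=
  (t (Multiplicative.ofAdd u) : kˣ)

/-- The value of the regular function `f ∈ k[M]` at a point of `T_M`. -/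
def Torus.eval {k M : Type*} [Field k] [AddCommGroup M] (f : AddMonoidAlgebra k M)
    (t : Torus k M) : k :=
  Finsupp.sum f.coeff fun u c => c * Torus.monomial u t

/-- The Zariski topology on `T_M`: the principal open sets `{f ≠ 0}`, `f ∈ k[M]`,
form a basis. -/
instance zariskiTorus (k M : Type*) [Field k] [AddCommGroup M] : TopologicalSpace (Torus k M) :=
  TopologicalSpace.generateFrom
    {U | ∃ f : AddMonoidAlgebra k M, U = {t | Torus.eval f t ≠ 0}}

/-- The morphism `T_{M₂} → T_{M₁}` induced by a homomorphism `M₁ → M₂`. -/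
def Torus.induced (k : Type*) [Field k] {M₁ M₂ : Type*} [AddCommGroup M₁] [AddCommGroup M₂]
    (f : M₁ →+ M₂) : Torus k M₂ →* Torus k M₁ :=
  MonoidHom.compHom' (AddMonoidHom.toMultiplicative f)

/-- The morphism `φ_A : T_M → ℙ^N, t ↦ [z^{u_0}(t) : ⋯ : z^{u_N}(t)]`. -/
def torusMap (k : Type*) [Field k] {M ι : Type*} [AddCommGroup M] [Nonempty ι] (u : ι → M)
    (t : Torus k M) : ℙ k (ι → k) :=
  Projectivization.mk k (fun i => Torus.monomial (u i) t)
    (fun h => (t (Multiplicative.ofAdd (u (Classical.arbitrary ι)))).ne_zero (congrFun h _))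

/-- The toric variety `X_A ⊆ ℙ^N` of a family `A = (u_i)` of points of `M`. -/
def toricVariety (k : Type*) [Field k] {M ι : Type*} [AddCommGroup M] [Nonempty ι]
    (u : ι → M) : Set (ℙ k (ι → k)) :=
  closure (Set.range (torusMap k u))

/-- The toric variety `X_S ⊆ ℙ^(#S - 1)` of a set `S` of points of `M`, its homogeneous
coordinates being indexed by the elements of `S`. -/
abbrev toricVarietyOfSet (k : Type*) [Field k] {M : Type*} [AddCommGroup M] (S : Set M)
    [Nonempty S] : Set (ℙ k (S → k)) :=
  toricVariety k (Subtype.val : S → M)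

/-- The subgroup `⟨S - S⟩` of `M`. -/
def diffLattice {M : Type*} [AddCommGroup M] (S : Set M) : AddSubgroup M :=
  AddSubgroup.closure (S - S)

/-- The inclusion of `T_{⟨S - S⟩}` in `X_S` as its open dense orbit:
`t ↦ [z^{b - b₀}(t)]_{b ∈ S}`. It does not depend on the choice of `b₀ ∈ S`. -/
def orbitMap (k : Type*) [Field k] {M : Type*} [AddCommGroup M] (S : Set M) (b₀ : S)
    (t : Torus k (diffLattice S)) : ℙ k (S → k) :=
  Projectivization.mk k
    (fun b => Torus.monomial (⟨b.1 - b₀.1,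
      AddSubgroup.subset_closure (Set.sub_mem_sub b.2 b₀.2)⟩ : diffLattice S) t)
    (fun h => (t (Multiplicative.ofAdd _)).ne_zero (congrFun h b₀))

/-- `φ` identifies the space `T` with a dense open subset of `X`. -/
def IsDenseOpenIn {T P : Type*} [TopologicalSpace T] [TopologicalSpace P] (φ : T → P)
    (X : Set P) : Prop :=
  Topology.IsEmbedding φ ∧ (∃ U : Set P, IsOpen U ∧ Set.range φ = X ∩ U) ∧
    X ⊆ closure (Set.range φ)

/-- The set `B` of the sums `u_{i_0} + ⋯ + u_{i_n}` such that `u_{i_0}, …, u_{i_n}` span the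
`k`-affine space `M_k = k ⊗ M`. -/
def spanningSums (k : Type*) [Field k] {M ι : Type*} [AddCommGroup M] (u : ι → M) (n : ℕ) :
    Set M :=
  {b | ∃ i : Fin (n + 1) → ι,
    affineSpan k (Set.range fun j => (1 : k) ⊗ₜ[ℤ] u (i j)) = ⊤ ∧ b = ∑ j, u (i j)}

/-- The subgroup `⟨S - S⟩_ℝ ∩ M` of `M`, where `⟨S - S⟩_ℝ` is the real subspace of `ℝ ⊗ M`
spanned by `S - S`. -/
def realSaturation {M : Type*} [AddCommGroup M] (S : Set M) : AddSubgroup M :=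
  (Submodule.span ℝ ((fun m : M => (1 : ℝ) ⊗ₜ[ℤ] m) '' (S - S))).toAddSubgroup.comap
    (TensorProduct.mk ℤ ℝ M 1).toAddMonoidHom

end

end ToricGauss

open ToricGauss

/-!
The tangent space of `X_A` at `φ_A(t)` is the row space of the matrix with columns
`z^{u_i}(t) • (u_i, 1) ∈ k ⊗ (M × ℤ)`, so its Plücker coordinate at `I` is the constant minor
`det (u_i, 1)_{i ∈ I}` times `z^{∑_{i ∈ I} u_i}(t)`. The minor is nonzero exactly when the `u_i`,
`i ∈ I`, span `M_k`. Hence, up to the linear embedding that repeats and rescales coordinates,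
`γ ∘ φ_A` is the monomial map of `B`, and the fibers of `γ` on the torus are the cosets of the
kernel of `T_M → T_{⟨B - B⟩}`, whose identity component is `T_{M'}`.

A fiber of `γ` over all smooth points may also meet the boundary of `X_A`. Any two points of `X_A`
with the same support differ by a translation by some `t ∈ T_M`; as translations act on `X_A` and
on its tangent spaces, `t` lies in that kernel when the two points have the same tangent space.
So such a fiber is covered by finitely many orbits of `T_{M'}`, and a space that embeds into
finitely many toric varieties of rank `d` has Krull dimension at most `d`.
-/

namespace ToricGauss

noncomputable section

/-! ### The Zariski topology of projective space -/

section Proj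

open MvPolynomial

variable {k : Type*} [Field k] {ι κ : Type*}

theorem eval_smul_of_isHomogeneous {f : MvPolynomial ι k} {d : ℕ} (hf : f.IsHomogeneous d)
    (c : k) (x : ι → k) : eval (c • x) f = c ^ d * eval x f := by
  rw [eval_eq, eval_eq, Finset.mul_sum]
  refine Finset.sum_congr rfl fun a ha => ?_
  have hdeg : ∑ i ∈ a.support, a i = d := by
    simpa [Finsupp.weight_apply, Finsupp.sum] using hf (mem_support_iff.1 ha)
  simp only [Pi.smul_apply, smul_eq_mul, mul_pow, Finset.prod_mul_distrib,
    Finset.prod_pow_eq_pow_sum, hdeg]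
  ring

theorem eval_rep_mk_eq_zero {f : MvPolynomial ι k} {d : ℕ} (hf : f.IsHomogeneous d)
    {v : ι → k} (hv : v ≠ 0) : eval (Projectivization.mk k v hv).rep f = 0 ↔ eval v f = 0 := by
  obtain ⟨a, ha⟩ := Projectivization.exists_smul_eq_mk_rep k v hv
  rw [← ha, Units.smul_def, eval_smul_of_isHomogeneous hf]
  simp

theorem isTopologicalBasis_zariskiProj :
    TopologicalSpace.IsTopologicalBasis
      {U : Set (ℙ k (ι → k)) | ∃ (d : ℕ) (f : MvPolynomial ι k), f.IsHomogeneous d ∧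
        U = {x | eval x.rep f ≠ 0}} where
  exists_subset_inter := by
    rintro _ ⟨d, f, hf, rfl⟩ _ ⟨e, g, hg, rfl⟩ x hx
    exact ⟨_, ⟨d + e, f * g, hf.mul hg, rfl⟩, by simpa using hx, fun y hy => by simpa using hy⟩
  sUnion_eq := Set.eq_univ_of_forall fun x => ⟨_, ⟨0, 1, isHomogeneous_one _ _, rfl⟩, by simp⟩
  eq_generateFrom := rfl

theorem isOpen_eval_ne_zero {f : MvPolynomial ι k} {d : ℕ} (hf : f.IsHomogeneous d) :
    IsOpen {x : ℙ k (ι → k) | eval x.rep f ≠ 0} :=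
  isTopologicalBasis_zariskiProj.isOpen ⟨d, f, hf, rfl⟩

theorem isOpen_forall_rep_ne_zero [Finite ι] : IsOpen {x : ℙ k (ι → k) | ∀ i, x.rep i ≠ 0} := by
  simp only [Set.ofPred_forall]
  exact isOpen_iInter_of_finite fun i => by simpa using isOpen_eval_ne_zero (isHomogeneous_X k i)

theorem mem_closure_iff_eval {Y : Set (ℙ k (ι → k))} {y : ℙ k (ι → k)} :
    y ∈ closure Y ↔ ∀ (d : ℕ) (f : MvPolynomial ι k), f.IsHomogeneous d →
      (∀ x ∈ Y, eval x.rep f = 0) → eval y.rep f = 0 := by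
  rw [isTopologicalBasis_zariskiProj.mem_closure_iff]
  constructor
  · intro h d f hf hY
    by_contra hy
    obtain ⟨x, hx, hxY⟩ := h _ ⟨d, f, hf, rfl⟩ hy
    exact hx (hY x hxY)
  · rintro h _ ⟨d, f, hf, rfl⟩ hy
    by_contra hne
    exact hy (h d f hf fun x hx => by_contra fun hx0 => hne ⟨x, hx0, hx⟩)

/-- The polynomial function `s ↦ f (s x)` on the line through the origin and `x`. -/
def lineRestrict (x : ι → k) : MvPolynomial ι k →ₐ[k] Polynomial k :=
  aeval fun i => Polynomial.C (x i) * Polynomial.X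

theorem eval_lineRestrict (x : ι → k) (f : MvPolynomial ι k) (s : k) :
    (lineRestrict x f).eval s = eval (s • x) f := by
  have h : (Polynomial.aeval s).comp (lineRestrict x) = aeval (s • x) :=
    algHom_ext fun i => by simp [lineRestrict, mul_comm s]
  simpa using DFunLike.congr_fun h f

theorem coeff_lineRestrict (x : ι → k) (f : MvPolynomial ι k) (d : ℕ) :
    (lineRestrict x f).coeff d = eval x (homogeneousComponent d f) := by
  induction f using induction_on' with
  | monomial a c =>
    have h : lineRestrict x (monomial a c) =
        Polynomial.C (eval x (monomial a c)) * Polynomial.X ^ a.degree := by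
      simp only [lineRestrict, aeval_monomial, eval_monomial, mul_pow, Finsupp.prod_mul]
      simp [Finsupp.prod, Finset.prod_pow_eq_pow_sum, Finsupp.degree_apply, mul_assoc]
    rw [h, Polynomial.coeff_C_mul_X_pow,
      homogeneousComponent_of_mem (isHomogeneous_monomial c rfl), apply_ite (eval x), map_zero]
  | add p q hp hq => simp [hp, hq]

theorem lineRestrict_rep_mk_eq_zero {x : ι → k} (hx : x ≠ 0) (f : MvPolynomial ι k) :
    lineRestrict (Projectivization.mk k x hx).rep f = 0 ↔ lineRestrict x f = 0 := by
  simp only [Polynomial.ext_iff, coeff_lineRestrict, Polynomial.coeff_zero,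
    eval_rep_mk_eq_zero (homogeneousComponent_isHomogeneous _ f)]

theorem isOpen_lineRestrict_ne_zero (f : MvPolynomial ι k) :
    IsOpen {x : ℙ k (ι → k) | lineRestrict x.rep f ≠ 0} := by
  have h : {x : ℙ k (ι → k) | lineRestrict x.rep f ≠ 0} =
      ⋃ d, {x | eval x.rep (homogeneousComponent d f) ≠ 0} := by
    ext x
    simp [Polynomial.ext_iff, coeff_lineRestrict]
  rw [h]
  exact isOpen_iUnion fun d => isOpen_eval_ne_zero (homogeneousComponent_isHomogeneous d f)

open Classical in
/-- The pullback of polynomial functions along a linear map. -/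
def linearSubst [Fintype ι] (R : (ι → k) →ₗ[k] (κ → k)) :
    MvPolynomial κ k →ₐ[k] MvPolynomial ι k :=
  aeval (LinearMap.toMatrix' R).toMvPolynomial

section Fintype

variable [Fintype ι] (R : (ι → k) →ₗ[k] (κ → k))

theorem eval_linearSubst (f : MvPolynomial κ k) (x : ι → k) :
    eval x (linearSubst R f) = eval (R x) f := by
  classical
  have h : (aeval x).comp (linearSubst R) = aeval (R x) := algHom_ext fun j => by
    simp [linearSubst, Matrix.toMvPolynomial_eval_eq_apply, LinearMap.toMatrix'_mulVec]
  simpa using DFunLike.congr_fun h f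

theorem isHomogeneous_linearSubst {f : MvPolynomial κ k} {d : ℕ} (hf : f.IsHomogeneous d) :
    (linearSubst R f).IsHomogeneous d := by
  classical
  have h := hf.aeval _ (Matrix.toMvPolynomial_isHomogeneous (LinearMap.toMatrix' R))
  rw [one_mul] at h
  rw [linearSubst]
  convert h

theorem lineRestrict_linearSubst (x : ι → k) (f : MvPolynomial κ k) :
    lineRestrict x (linearSubst R f) = lineRestrict (R x) f := by
  classical
  have h : (lineRestrict x).comp (linearSubst R) = lineRestrict (R x) := algHom_ext fun j => by
    have hj := congrFun (LinearMap.toMatrix'_mulVec R x) j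
    simp only [Matrix.mulVec, dotProduct] at hj
    simp only [linearSubst, AlgHom.comp_apply, aeval_X, Matrix.toMvPolynomial, map_sum, ← hj,
      lineRestrict, aeval_monomial, Finset.sum_mul]
    exact Finset.sum_congr rfl fun i _ => by simp [mul_assoc]
  exact DFunLike.congr_fun h f

variable (hR : Function.Injective R)

theorem lineRestrict_rep_map_eq_zero (f : MvPolynomial κ k) (x : ℙ k (ι → k)) :
    lineRestrict (Projectivization.map R hR x).rep f = 0 ↔
      lineRestrict x.rep (linearSubst R f) = 0 := by
  rw [lineRestrict_linearSubst]
  conv_lhs => rw [← x.mk_rep, Projectivization.map_mk]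
  exact lineRestrict_rep_mk_eq_zero _ f

theorem eval_rep_map_eq_zero {f : MvPolynomial κ k} {d : ℕ} (hf : f.IsHomogeneous d)
    (x : ℙ k (ι → k)) :
    eval (Projectivization.map R hR x).rep f = 0 ↔ eval x.rep (linearSubst R f) = 0 := by
  rw [eval_linearSubst]
  conv_lhs => rw [← x.mk_rep, Projectivization.map_mk]
  exact eval_rep_mk_eq_zero hf _

end Fintype

section ProjectivizationMap

variable [Finite ι] (R : (ι → k) →ₗ[k] (κ → k)) (hR : Function.Injective R)

theorem continuous_projectivizationMap : Continuous (Projectivization.map R hR) := by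
  have := Fintype.ofFinite ι
  refine continuous_generateFrom_iff.2 ?_
  rintro _ ⟨d, f, hf, rfl⟩
  convert isOpen_eval_ne_zero (isHomogeneous_linearSubst R hf) using 1
  ext x
  exact (eval_rep_map_eq_zero R hR hf x).not

theorem isClosedEmbedding_projectivizationMap [Finite κ] :
    Topology.IsClosedEmbedding (Projectivization.map R hR) := by
  have := Fintype.ofFinite ι
  have := Fintype.ofFinite κ
  obtain ⟨g, hg⟩ := LinearMap.exists_leftInverse_of_injective _ (LinearMap.ker_eq_bot.2 hR)
  have hgR : ∀ x, g (R x) = x := LinearMap.congr_fun hg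
  have hmap : ∀ {d} {f : MvPolynomial ι k}, f.IsHomogeneous d → ∀ x : ℙ k (ι → k),
      eval (Projectivization.map R hR x).rep (linearSubst g f) = 0 ↔ eval x.rep f = 0 :=
    fun {d f} hf x => by
      rw [eval_rep_map_eq_zero R hR (isHomogeneous_linearSubst g hf), eval_linearSubst,
        eval_linearSubst, hgR]
  refine ⟨⟨⟨le_antisymm (continuous_projectivizationMap R hR).le_induced
    (le_generateFrom ?_)⟩, Projectivization.map_injective R hR⟩, ?_⟩
  · rintro _ ⟨d, f, hf, rfl⟩
    refine ⟨_, isOpen_eval_ne_zero (isHomogeneous_linearSubst g hf), ?_⟩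
    ext x
    exact (hmap hf x).not
  · -- the range is cut out by the linear equations `R (g y) = y`
    refine isClosed_of_closure_subset fun y hy => ?_
    have hy' : R (g y.rep) = y.rep := by
      funext j
      have hX := isHomogeneous_linearSubst (R.comp g - LinearMap.id) (isHomogeneous_X k j)
      have h1 := mem_closure_iff_eval.1 hy 1 _ hX (by
        rintro _ ⟨x, rfl⟩
        rw [eval_rep_map_eq_zero R hR hX, eval_linearSubst, eval_linearSubst]
        simp [hgR])
      simpa [eval_linearSubst, sub_eq_zero] using h1
    have hne : g y.rep ≠ 0 := fun h0 => y.rep_nonzero (by rw [← hy', h0, map_zero])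
    refine ⟨Projectivization.mk k _ hne, ?_⟩
    rw [Projectivization.map_mk]
    simp only [hy', Projectivization.mk_rep]

end ProjectivizationMap

end Proj

/-! ### Tori -/

section Torus

variable {k : Type*} [Field k] {M M₁ M₂ : Type*} [AddCommGroup M] [AddCommGroup M₁]
  [AddCommGroup M₂]

namespace Torus

theorem monomial_ne_zero (u : M) (t : Torus k M) : monomial u t ≠ 0 :=
  (t (Multiplicative.ofAdd u)).ne_zero

theorem monomial_add (u v : M) (t : Torus k M) :
    monomial (u + v) t = monomial u t * monomial v t := by
  simp [monomial]

@[simp] theorem monomial_zero (t : Torus k M) : monomial 0 t = 1 := by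
  simp [monomial]

theorem monomial_zsmul (a : ℤ) (u : M) (t : Torus k M) :
    monomial (a • u) t = monomial u t ^ a := by
  simp [monomial]

theorem monomial_neg (u : M) (t : Torus k M) : monomial (-u) t = (monomial u t)⁻¹ := by
  simp [monomial]

theorem monomial_sub (u v : M) (t : Torus k M) :
    monomial (u - v) t = monomial u t / monomial v t := by
  simp [monomial]

theorem monomial_sum {ι : Type*} (s : Finset ι) (u : ι → M) (t : Torus k M) :
    monomial (∑ i ∈ s, u i) t = ∏ i ∈ s, monomial (u i) t := by
  simp [monomial, ofAdd_sum]

theorem monomial_mul (u : M) (s t : Torus k M) :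
    monomial u (s * t) = monomial u s * monomial u t := by
  simp [monomial]

@[simp] theorem monomial_one (u : M) : monomial u (1 : Torus k M) = 1 := by
  simp [monomial]

theorem monomial_inv (u : M) (t : Torus k M) : monomial u t⁻¹ = (monomial u t)⁻¹ := by
  simp [monomial]

theorem monomial_induced (f : M₁ →+ M₂) (u : M₁) (t : Torus k M₂) :
    monomial u (induced k f t) = monomial (f u) t := rfl

theorem ext_monomial {s t : Torus k M} (h : ∀ u, monomial u s = monomial u t) : s = t :=
  MonoidHom.ext fun u => Units.ext (h u.toAdd)

/-- Evaluation at a point of the torus, as a homomorphism of algebras. -/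
def evalHom (t : Torus k M) : AddMonoidAlgebra k M →ₐ[k] k :=
  AddMonoidAlgebra.lift k k M ((Units.coeHom k).comp t)

theorem evalHom_apply (f : AddMonoidAlgebra k M) (t : Torus k M) : evalHom t f = eval f t := by
  simp [evalHom, AddMonoidAlgebra.lift_apply, eval, monomial]

theorem eval_single (u : M) (c : k) (t : Torus k M) :
    eval (AddMonoidAlgebra.single u c) t = c * monomial u t := by
  simp [eval]

theorem eval_mul (f g : AddMonoidAlgebra k M) (t : Torus k M) :
    eval (f * g) t = eval f t * eval g t := by
  simp only [← evalHom_apply, map_mul]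

theorem isTopologicalBasis : TopologicalSpace.IsTopologicalBasis
    {U : Set (Torus k M) | ∃ f : AddMonoidAlgebra k M, U = {t | eval f t ≠ 0}} where
  exists_subset_inter := by
    rintro _ ⟨f, rfl⟩ _ ⟨g, rfl⟩ x hx
    exact ⟨_, ⟨f * g, rfl⟩, by simpa [eval_mul] using hx, fun y hy => by simpa [eval_mul] using hy⟩
  sUnion_eq := Set.eq_univ_of_forall fun x => ⟨_, ⟨1, rfl⟩, by simp [← evalHom_apply]⟩
  eq_generateFrom := rfl

theorem isOpen_eval_ne_zero (f : AddMonoidAlgebra k M) : IsOpen {t | eval f t ≠ 0} :=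
  isTopologicalBasis.isOpen ⟨f, rfl⟩

theorem isClosed_monomial_eq (u : M) (c : k) : IsClosed {t : Torus k M | monomial u t = c} := by
  rw [← isOpen_compl_iff]
  convert isOpen_eval_ne_zero (AddMonoidAlgebra.single u (1 : k) - algebraMap k _ c) using 1
  ext t
  simp only [Set.mem_compl_iff, Set.mem_ofPred_eq, ← evalHom_apply, map_sub, AlgHom.commutes]
  simp only [evalHom_apply, eval_single, one_mul, Algebra.algebraMap_self_apply, ne_eq, sub_eq_zero]

theorem continuous_of_eval_comp {φ : Torus k M₁ → Torus k M₂}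
    (e : AddMonoidAlgebra k M₂ →ₐ[k] AddMonoidAlgebra k M₁)
    (h : ∀ u t, eval (e (AddMonoidAlgebra.single u 1)) t = monomial u (φ t)) : Continuous φ := by
  refine isTopologicalBasis.continuous_iff.2 ?_
  rintro _ ⟨g, rfl⟩
  convert isOpen_eval_ne_zero (e g) using 1
  ext t
  have he : (evalHom t).comp e = evalHom (φ t) :=
    AddMonoidAlgebra.algHom_ext
      (fun u => by simp [evalHom_apply, h, eval_single]) (Subsingleton.elim _ _)
  have hg : eval (e g) t = eval g (φ t) := by simpa [evalHom_apply] using DFunLike.congr_fun he g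
  simp [hg]

theorem continuous_induced (f : M₁ →+ M₂) : Continuous (induced k f) :=
  continuous_of_eval_comp (AddMonoidAlgebra.mapDomainAlgHom k k f)
    fun u t => by simp [eval_single, monomial_induced]

theorem continuous_mul_left (s : Torus k M) : Continuous (fun t => s * t) :=
  continuous_of_eval_comp
    (AddMonoidAlgebra.lift k _ M
      { toFun := fun u => AddMonoidAlgebra.single u.toAdd (monomial u.toAdd s)
        map_one' := by simp [AddMonoidAlgebra.one_def]
        map_mul' := fun u v => by simp [AddMonoidAlgebra.single_mul_single, monomial_add] })
    fun u t => by simp [eval_single, monomial_mul]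

section Basis

variable {ι : Type*} (b : Module.Basis ι ℤ M)

/-- The point of a torus with prescribed coordinates in a basis of the lattice. -/
def ofBasis (a : ι → kˣ) : Torus k M :=
  AddMonoidHom.toMultiplicativeLeft
    ((b.constr ℤ fun i => Additive.ofMul (a i)) : M →ₗ[ℤ] Additive kˣ).toAddMonoidHom

theorem monomial_ofBasis_self (a : ι → kˣ) (i : ι) : monomial (b i) (ofBasis b a) = a i := by
  simp [monomial, ofBasis]

theorem monomial_eq_prod_repr [Fintype ι] (u : M) (t : Torus k M) :
    monomial u t = ∏ i, monomial (b i) t ^ b.repr u i := by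
  conv_lhs => rw [← b.sum_repr u]
  simp only [monomial_sum, monomial_zsmul]

theorem ext_basis [Finite ι] {s t : Torus k M} (h : ∀ i, monomial (b i) s = monomial (b i) t) :
    s = t := by
  have := Fintype.ofFinite ι
  exact ext_monomial fun u => by simp only [monomial_eq_prod_repr b u, h]

end Basis

theorem exists_zpow_ne_one [Infinite k] {d : ℤ} (hd : d ≠ 0) : ∃ c : kˣ, c ^ d ≠ 1 := by
  classical
  by_contra! h
  have : NeZero d.natAbs := ⟨Int.natAbs_ne_zero.2 hd⟩
  have htop : ∀ c : kˣ, c ∈ rootsOfUnity d.natAbs k := fun c => by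
    rw [mem_rootsOfUnity, ← zpow_natCast]
    rcases Int.natAbs_eq d with hd' | hd'
    · rw [← hd', h]
    · rw [← inv_inj, ← zpow_neg, ← hd', h, inv_one]
  have : Finite kˣ := Finite.of_injective (fun c => (⟨c, htop c⟩ : rootsOfUnity d.natAbs k))
    fun c c' hcc => congrArg Subtype.val hcc
  have : Finite k := Finite.of_equiv (Option kˣ) (WithZero.withZeroUnitsEquiv (G := k)).toEquiv
  exact not_finite k

section Free

variable [Infinite k] [Module.Free ℤ M] [Module.Finite ℤ M]

theorem monomial_injective : Function.Injective (monomial : M → Torus k M → k) := by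
  classical
  intro u v h
  let b := Module.Free.chooseBasis ℤ M
  refine b.ext_elem fun i => ?_
  by_contra hne
  obtain ⟨c, hc⟩ := exists_zpow_ne_one (k := k) (sub_ne_zero.2 hne)
  have huv := congrFun h (ofBasis b (Pi.mulSingle i c))
  rw [monomial_eq_prod_repr b u, monomial_eq_prod_repr b v] at huv
  simp only [monomial_ofBasis_self] at huv
  rw [Fintype.prod_eq_single i, Fintype.prod_eq_single i, Pi.mulSingle_eq_same] at huv
  · refine hc ?_
    rw [zpow_sub, mul_inv_eq_one]
    exact_mod_cast huv
  all_goals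
    intro j hj
    rw [Pi.mulSingle_eq_of_ne hj, Units.val_one, one_zpow]

theorem eq_zero_of_eval_eq_zero {f : AddMonoidAlgebra k M} (h : ∀ t, eval f t = 0) : f = 0 := by
  let χ : M → (Torus k M →* k) := fun u =>
    { toFun := monomial u
      map_one' := monomial_one u
      map_mul' := monomial_mul u }
  have hχ : Function.Injective χ := fun u v huv =>
    monomial_injective (funext fun t => DFunLike.congr_fun huv t)
  have hli := (linearIndependent_monoidHom (Torus k M) k).comp χ hχ
  refine AddMonoidAlgebra.coeff_eq_zero.1 (linearIndependent_iff.1 hli f.coeff (funext fun t => ?_))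
  simpa [Finsupp.linearCombination_apply, Finsupp.sum, eval, χ] using h t

end Free

theorem isDomain_addMonoidAlgebra [Module.Free ℤ M] : IsDomain (AddMonoidAlgebra k M) := by
  let b := Module.Free.chooseBasis ℤ M
  have : UniqueSums M := UniqueSums.of_injective_addHom
    (b.repr.toLinearMap.toAddMonoidHom : M →+ _).toAddHom b.repr.injective inferInstance
  infer_instance

theorem isIrreducible_univ [Infinite k] [Module.Free ℤ M] [Module.Finite ℤ M] :
    IsIrreducible (Set.univ : Set (Torus k M)) := by
  refine ⟨⟨1, trivial⟩, ?_⟩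
  intro U V hU hV ⟨x, _, hx⟩ ⟨y, _, hy⟩
  obtain ⟨_, ⟨f, rfl⟩, hxf, hfU⟩ := isTopologicalBasis.exists_subset_of_mem_open hx hU
  obtain ⟨_, ⟨g, rfl⟩, hyg, hgV⟩ := isTopologicalBasis.exists_subset_of_mem_open hy hV
  have := isDomain_addMonoidAlgebra (k := k) (M := M)
  have hfg : f * g ≠ 0 := mul_ne_zero
    (by rintro rfl; exact hxf (by simp [← evalHom_apply]))
    (by rintro rfl; exact hyg (by simp [← evalHom_apply]))
  obtain ⟨t, ht⟩ : ∃ t, eval (f * g) t ≠ 0 := by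
    by_contra! h
    exact hfg (eq_zero_of_eval_eq_zero h)
  rw [eval_mul] at ht
  exact ⟨t, trivial, hfU (left_ne_zero_of_mul ht), hgV (right_ne_zero_of_mul ht)⟩

theorem units_smul_surjective [IsAlgClosed k] {d : ℕ} (hd : d ≠ 0) :
    Function.Surjective fun x : Additive kˣ => d • x := by
  intro x
  obtain ⟨z, hz⟩ := IsAlgClosed.exists_pow_nat_eq (x.toMul : k) (Nat.pos_of_ne_zero hd)
  have hz0 : z ≠ 0 := fun h => x.toMul.ne_zero (by rw [← hz, h, zero_pow hd])
  exact ⟨Additive.ofMul (Units.mk0 z hz0), Additive.toMul.injective (Units.ext hz)⟩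

/-- Divisibility of `kˣ` makes it an injective abelian group, so characters extend. -/
theorem exists_induced_eq [IsAlgClosed k] (f : M₁ →+ M₂) (s : Torus k M₁)
    (h : ∀ m, f m = 0 → monomial m s = 1) : ∃ t : Torus k M₂, induced k f t = s := by
  let : DivisibleBy (Additive kˣ) ℕ :=
    divisibleByOfSMulRightSurj (Additive kˣ) ℕ units_smul_surjective
  let : DivisibleBy (Additive kˣ) ℤ := AddGroup.divisibleByIntOfDivisibleByNat (Additive kˣ)
  have hker : f.ker ≤ (MonoidHom.toAdditiveRight s).ker := fun m hm => Units.ext (h m hm)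
  obtain ⟨g, hg⟩ := (Module.Baer.of_divisible (Additive kˣ)).extension_property_addMonoidHom
    (QuotientAddGroup.kerLift f) (QuotientAddGroup.kerLift_injective f)
    (QuotientAddGroup.lift f.ker (MonoidHom.toAdditiveRight s) hker)
  refine ⟨AddMonoidHom.toMultiplicativeLeft g, ext_monomial fun m => ?_⟩
  exact congrArg (fun x : Additive kˣ => (x.toMul : k)) (DFunLike.congr_fun hg (m : M₁ ⧸ f.ker))

end Torus

end Torus

/-! ### Toric varieties -/

section Toric

theorem linearCombination_mapRange_natCast {L ι : Type*} [AddCommGroup L] (w : ι → L)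
    (a : ι →₀ ℕ) : Finsupp.linearCombination ℤ w (a.mapRange Nat.cast rfl) =
      Finsupp.linearCombination ℕ w a := by
  simp [Finsupp.linearCombination_apply, Finsupp.sum_mapRange_index]

theorem linearCombination_eq_zero_of_nat {L G ι : Type*} [AddCommGroup L] [AddCommGroup G]
    {w : ι → L} {x : ι → G}
    (h : ∀ a b : ι →₀ ℕ, Finsupp.linearCombination ℕ w a = Finsupp.linearCombination ℕ w b →
      Finsupp.linearCombination ℕ x a = Finsupp.linearCombination ℕ x b)
    {m : ι →₀ ℤ} (hm : Finsupp.linearCombination ℤ w m = 0) :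
    Finsupp.linearCombination ℤ x m = 0 := by
  let p : ι →₀ ℕ := m.mapRange Int.toNat rfl
  let q : ι →₀ ℕ := m.mapRange (fun z => (-z).toNat) rfl
  have hpq : m = p.mapRange Nat.cast rfl - q.mapRange Nat.cast rfl :=
    Finsupp.ext fun i => (Int.toNat_sub_toNat_neg (m i)).symm
  rw [hpq, map_sub, sub_eq_zero, linearCombination_mapRange_natCast,
    linearCombination_mapRange_natCast] at hm ⊢
  exact h p q hm

theorem diffLattice_eq_top {L : Type*} [AddCommGroup L] {S : Set L} (hS : affineSpan ℤ S = ⊤) :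
    diffLattice S = ⊤ := by
  have h := AffineSubspace.vectorSpan_eq_top_of_affineSpan_eq_top ℤ L L hS
  rw [diffLattice, ← Submodule.span_int_eq_addSubgroupClosure]
  exact congrArg Submodule.toAddSubgroup h

variable {k : Type*} [Field k] {L ι : Type*} [AddCommGroup L]

/-- The family `(v_i, 1)` in `L × ℤ`: its monomials parametrize the affine cone over the toric
variety of `v`. -/
def homogenize (v : ι → L) (i : ι) : L × ℤ := (v i, 1)

theorem monomial_homogenize (v : ι → L) (i : ι) (t : Torus k (L × ℤ)) :
    Torus.monomial (homogenize v i) t =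
      Torus.monomial (0, 1) t *
        Torus.monomial (v i) (Torus.induced k (AddMonoidHom.inl L ℤ) t) := by
  rw [Torus.monomial_induced, ← Torus.monomial_add]
  simp [homogenize]

theorem exists_monomial_homogenize_eq (v : ι → L) (t : Torus k L) (c : kˣ) :
    ∃ T : Torus k (L × ℤ), ∀ i, Torus.monomial (homogenize v i) T = c * Torus.monomial (v i) t := by
  let z : Torus k ℤ := zpowersHom kˣ c
  refine ⟨Torus.induced k (AddMonoidHom.snd L ℤ) z * Torus.induced k (AddMonoidHom.fst L ℤ) t,
    fun i => ?_⟩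
  rw [Torus.monomial_mul, Torus.monomial_induced, Torus.monomial_induced]
  simp [homogenize, z, Torus.monomial]

variable (k) in
/-- The substitution `x_i ↦ z^{w_i}`; its kernel is the toric ideal of the family `w`. -/
def monomialSubst (w : ι → L) : MvPolynomial ι k →ₐ[k] AddMonoidAlgebra k L :=
  MvPolynomial.aeval fun i => AddMonoidAlgebra.single (w i) 1

theorem eval_monomialSubst (w : ι → L) (f : MvPolynomial ι k) (t : Torus k L) :
    Torus.eval (monomialSubst k w f) t =
      MvPolynomial.eval (fun i => Torus.monomial (w i) t) f := by
  have h : (Torus.evalHom t).comp (monomialSubst k w) =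
      MvPolynomial.aeval (fun i => Torus.monomial (w i) t) :=
    MvPolynomial.algHom_ext fun i => by
      simp [monomialSubst, Torus.evalHom_apply, Torus.eval_single]
  simpa [Torus.evalHom_apply] using DFunLike.congr_fun h f

theorem monomialSubst_monomial (w : ι → L) (a : ι →₀ ℕ) :
    monomialSubst k w (MvPolynomial.monomial a 1) =
      AddMonoidAlgebra.single (Finsupp.linearCombination ℕ w a) 1 := by
  simp [monomialSubst, MvPolynomial.aeval_monomial, Finsupp.prod, Finsupp.linearCombination_apply,
    Finsupp.sum, AddMonoidAlgebra.single_pow, AddMonoidAlgebra.prod_single]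

/-- A full-support solution of the binomial equations of `w` is a point of the torus. -/
theorem exists_torus_monomial_eq [IsAlgClosed k] {w : ι → L} {x : ι → kˣ}
    (h : ∀ a b : ι →₀ ℕ, Finsupp.linearCombination ℕ w a = Finsupp.linearCombination ℕ w b →
      (a.prod fun i e => x i ^ e) = b.prod fun i e => x i ^ e) :
    ∃ t : Torus k L, ∀ i, Torus.monomial (w i) t = x i := by
  let χ := Finsupp.linearCombination ℤ fun i => Additive.ofMul (x i)
  have hχ : ∀ m, Finsupp.linearCombination ℤ w m = 0 → χ m = 0 := fun m =>
    linearCombination_eq_zero_of_nat fun a b hab => by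
      simpa [Finsupp.linearCombination_apply, Finsupp.sum, Finsupp.prod, ← ofMul_pow,
        ← ofMul_prod] using h a b hab
  obtain ⟨t, ht⟩ := Torus.exists_induced_eq (Finsupp.linearCombination ℤ w).toAddMonoidHom
    (AddMonoidHom.toMultiplicativeLeft χ.toAddMonoidHom)
    fun m hm => congrArg (fun c : Additive kˣ => (c.toMul : k)) (hχ m hm)
  refine ⟨t, fun i => ?_⟩
  have hi := congrArg (Torus.monomial (Finsupp.single i 1)) ht
  rw [Torus.monomial_induced] at hi
  simpa [Torus.monomial, χ] using hi

/-- The regular function `f` on the torus becomes a quotient of forms of equal degree in the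
coordinates `z^{v_i}`, with a denominator that does not vanish on the torus. -/
def IsFormQuotient (v : ι → L) (f : AddMonoidAlgebra k L) : Prop :=
  ∃ (d : ℕ) (F G : MvPolynomial ι k), F.IsHomogeneous d ∧ G.IsHomogeneous d ∧ ∀ t : Torus k L,
    MvPolynomial.eval (fun i => Torus.monomial (v i) t) G ≠ 0 ∧
    Torus.eval f t = MvPolynomial.eval (fun i => Torus.monomial (v i) t) F /
      MvPolynomial.eval (fun i => Torus.monomial (v i) t) G

theorem isFormQuotient_single_one {v : ι → L} (hv : affineSpan ℤ (Set.range v) = ⊤) (m : L) :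
    IsFormQuotient (k := k) v (AddMonoidAlgebra.single m 1) := by
  have hm : m ∈ diffLattice (Set.range v) := diffLattice_eq_top hv ▸ AddSubgroup.mem_top m
  simp only [IsFormQuotient, Torus.eval_single, one_mul]
  induction hm using AddSubgroup.closure_induction with
  | mem m hm =>
    obtain ⟨_, ⟨i, rfl⟩, _, ⟨j, rfl⟩, rfl⟩ := hm
    refine ⟨1, .X i, .X j, MvPolynomial.isHomogeneous_X k i, MvPolynomial.isHomogeneous_X k j,
      fun t => ?_⟩
    simp [Torus.monomial_sub, Torus.monomial_ne_zero]
  | zero =>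
    exact ⟨0, 1, 1, MvPolynomial.isHomogeneous_one _ _, MvPolynomial.isHomogeneous_one _ _,
      fun t => by simp [Torus.monomial_zero]⟩
  | add m m' _ _ h h' =>
    obtain ⟨d, F, G, hF, hG, hFG⟩ := h
    obtain ⟨d', F', G', hF', hG', hFG'⟩ := h'
    refine ⟨_, F * F', G * G', hF.mul hF', hG.mul hG', fun t => ⟨?_, ?_⟩⟩
    · simpa using ⟨(hFG t).1, (hFG' t).1⟩
    · rw [Torus.monomial_add, (hFG t).2, (hFG' t).2, map_mul, map_mul, div_mul_div_comm]
  | neg m _ h =>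
    obtain ⟨d, F, G, hF, hG, hFG⟩ := h
    refine ⟨d, G, F, hG, hF, fun t => ⟨fun h0 => Torus.monomial_ne_zero m t ?_, ?_⟩⟩
    · rw [(hFG t).2, h0, zero_div]
    · rw [Torus.monomial_neg, (hFG t).2, inv_div]

theorem isFormQuotient {v : ι → L} (hv : affineSpan ℤ (Set.range v) = ⊤)
    (f : AddMonoidAlgebra k L) : IsFormQuotient v f := by
  induction f using AddMonoidAlgebra.induction_linear with
  | zero =>
    exact ⟨0, 0, 1, MvPolynomial.isHomogeneous_zero _ _ _, MvPolynomial.isHomogeneous_one _ _,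
      fun t => by simp [Torus.eval]⟩
  | add f f' h h' =>
    obtain ⟨d, F, G, hF, hG, hFG⟩ := h
    obtain ⟨d', F', G', hF', hG', hFG'⟩ := h'
    refine ⟨_, F * G' + G * F', G * G', (hF.mul hG').add (hG.mul hF'), hG.mul hG',
      fun t => ⟨?_, ?_⟩⟩
    · simpa using ⟨(hFG t).1, (hFG' t).1⟩
    · rw [← Torus.evalHom_apply, map_add, Torus.evalHom_apply, Torus.evalHom_apply, (hFG t).2,
        (hFG' t).2, map_add, map_mul, map_mul, map_mul, div_add_div _ _ (hFG t).1 (hFG' t).1]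
  | single m c =>
    obtain ⟨d, F, G, hF, hG, hFG⟩ := isFormQuotient_single_one (k := k) hv m
    refine ⟨d, MvPolynomial.C c * F, G, zero_add d ▸ (MvPolynomial.isHomogeneous_C ι c).mul hF, hG,
      fun t => ⟨(hFG t).1, ?_⟩⟩
    have h := (hFG t).2
    rw [Torus.eval_single, one_mul] at h
    rw [Torus.eval_single, h, map_mul, MvPolynomial.eval_C, mul_div_assoc]

variable [Nonempty ι]

theorem lineRestrict_eq_zero_of_mem_toricVariety [Infinite k] {v : ι → L} {y : ℙ k (ι → k)}
    (hy : y ∈ toricVariety k v) {f : MvPolynomial ι k} (hf : monomialSubst k (homogenize v) f = 0) :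
    lineRestrict y.rep f = 0 := by
  have hclosed : IsClosed {y : ℙ k (ι → k) | lineRestrict y.rep f = 0} := by
    rw [← isOpen_compl_iff]
    exact isOpen_lineRestrict_ne_zero f
  refine closure_minimal ?_ hclosed hy
  rintro _ ⟨t, rfl⟩
  refine (lineRestrict_rep_mk_eq_zero _ f).2 (Polynomial.eq_zero_of_infinite_isRoot _
    ((Set.finite_singleton (0 : k)).infinite_compl.mono fun c hc => ?_))
  obtain ⟨T, hT⟩ := exists_monomial_homogenize_eq v t (Units.mk0 c hc)
  have h0 : MvPolynomial.eval (fun i => Torus.monomial (homogenize v i) T) f = 0 := by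
    rw [← eval_monomialSubst, hf]
    simp [Torus.eval]
  rw [Set.mem_ofPred_eq, Polynomial.IsRoot, eval_lineRestrict, ← h0]
  exact congrArg (MvPolynomial.eval · f) (funext fun i => (hT i).symm)

theorem prod_rep_pow_eq_of_mem_toricVariety [Infinite k] {v : ι → L} {y : ℙ k (ι → k)}
    (hy : y ∈ toricVariety k v) {a b : ι →₀ ℕ}
    (hab : Finsupp.linearCombination ℕ (homogenize v) a =
      Finsupp.linearCombination ℕ (homogenize v) b) :
    (a.prod fun i e => y.rep i ^ e) = b.prod fun i e => y.rep i ^ e := by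
  have h := lineRestrict_eq_zero_of_mem_toricVariety hy
    (f := MvPolynomial.monomial a 1 - MvPolynomial.monomial b 1)
    (by rw [map_sub, monomialSubst_monomial, monomialSubst_monomial, hab, sub_self])
  have h1 := eval_lineRestrict y.rep (MvPolynomial.monomial a 1 - MvPolynomial.monomial b 1) 1
  rw [h, Polynomial.eval_zero, one_smul, map_sub, MvPolynomial.eval_monomial,
    MvPolynomial.eval_monomial, one_mul, one_mul] at h1
  exact sub_eq_zero.1 h1.symm

theorem exists_torus_eq_rep_of_mem_toricVariety [IsAlgClosed k] {v : ι → L} {y : ℙ k (ι → k)}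
    (hy : y ∈ toricVariety k v) :
    ∃ t : Torus k (L × ℤ), ∀ i, y.rep i ≠ 0 → Torus.monomial (homogenize v i) t = y.rep i := by
  have : Infinite k := IsAlgClosed.instInfinite
  obtain ⟨t, ht⟩ := exists_torus_monomial_eq
    (w := fun i : {i // y.rep i ≠ 0} => homogenize v i) (x := fun i => Units.mk0 (y.rep i) i.2)
    fun a b hab => by
      have hab' := prod_rep_pow_eq_of_mem_toricVariety hy (a := a.mapDomain Subtype.val)
        (b := b.mapDomain Subtype.val)
        (by rw [Finsupp.linearCombination_mapDomain, Finsupp.linearCombination_mapDomain]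
            exact hab)
      rw [Finsupp.prod_mapDomain_index_inj Subtype.val_injective,
        Finsupp.prod_mapDomain_index_inj Subtype.val_injective] at hab'
      ext
      simpa [Finsupp.prod] using hab'
  exact ⟨t, fun i hi => ht ⟨i, hi⟩⟩

theorem eval_rep_torusMap_eq_zero (v : ι → L) (t : Torus k L) {f : MvPolynomial ι k} {d : ℕ}
    (hf : f.IsHomogeneous d) : MvPolynomial.eval (torusMap k v t).rep f = 0 ↔
      MvPolynomial.eval (fun i => Torus.monomial (v i) t) f = 0 :=
  eval_rep_mk_eq_zero hf _

theorem rep_torusMap_ne_zero (v : ι → L) (t : Torus k L) (i : ι) : (torusMap k v t).rep i ≠ 0 := by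
  simpa using (eval_rep_torusMap_eq_zero v t (MvPolynomial.isHomogeneous_X k i)).not.2
    (by simpa using Torus.monomial_ne_zero (v i) t)

theorem range_torusMap [IsAlgClosed k] (v : ι → L) :
    Set.range (torusMap k v) = toricVariety k v ∩ {x | ∀ i, x.rep i ≠ 0} := by
  ext y
  constructor
  · rintro ⟨t, rfl⟩
    exact ⟨subset_closure ⟨t, rfl⟩, rep_torusMap_ne_zero v t⟩
  · rintro ⟨hy, hne⟩
    obtain ⟨t, ht⟩ := exists_torus_eq_rep_of_mem_toricVariety hy
    refine ⟨Torus.induced k (AddMonoidHom.inl L ℤ) t, ?_⟩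
    rw [← y.mk_rep, torusMap, eq_comm, Projectivization.mk_eq_mk_iff']
    exact ⟨Torus.monomial (0, 1) t, funext fun i => by
      rw [Pi.smul_apply, smul_eq_mul, ← monomial_homogenize, ht i (hne i)]⟩

theorem continuous_torusMap (v : ι → L) : Continuous (torusMap k v) := by
  refine isTopologicalBasis_zariskiProj.continuous_iff.2 ?_
  rintro _ ⟨d, f, hf, rfl⟩
  convert Torus.isOpen_eval_ne_zero (monomialSubst k v f) using 1
  ext t
  simp only [Set.mem_preimage, Set.mem_ofPred_eq, ne_eq, eval_rep_torusMap_eq_zero v t hf,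
    eval_monomialSubst]

theorem torusMap_eq_iff {v : ι → L} {s t : Torus k L} :
    torusMap k v s = torusMap k v t ↔
      ∀ m ∈ diffLattice (Set.range v), Torus.monomial m s = Torus.monomial m t := by
  rw [torusMap, torusMap, Projectivization.mk_eq_mk_iff']
  constructor
  · rintro ⟨c, hc⟩ m hm
    induction hm using AddSubgroup.closure_induction with
    | mem m hm =>
      obtain ⟨_, ⟨i, rfl⟩, _, ⟨j, rfl⟩, rfl⟩ := hm
      have hs : ∀ i, Torus.monomial (v i) s = c * Torus.monomial (v i) t := fun i =>
        (congrFun hc i).symm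
      have hc0 : c ≠ 0 := left_ne_zero_of_mul (hs i ▸ Torus.monomial_ne_zero (v i) s)
      rw [Torus.monomial_sub, Torus.monomial_sub, hs, hs, mul_div_mul_left _ _ hc0]
    | zero => simp only [Torus.monomial_zero]
    | add m m' _ _ h h' => rw [Torus.monomial_add, Torus.monomial_add, h, h']
    | neg m _ h => rw [Torus.monomial_neg, Torus.monomial_neg, h]
  · intro h
    obtain ⟨j⟩ := ‹Nonempty ι›
    refine ⟨Torus.monomial (v j) s / Torus.monomial (v j) t, funext fun i => ?_⟩
    have hij := h _ (AddSubgroup.subset_closure (Set.sub_mem_sub ⟨i, rfl⟩ ⟨j, rfl⟩))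
    rw [Torus.monomial_sub, Torus.monomial_sub] at hij
    rw [div_eq_div_iff (Torus.monomial_ne_zero _ _) (Torus.monomial_ne_zero _ _)] at hij
    rw [Pi.smul_apply, smul_eq_mul, div_mul_eq_mul_div, div_eq_iff (Torus.monomial_ne_zero _ _)]
    linear_combination -hij

theorem isEmbedding_torusMap {v : ι → L} (hv : affineSpan ℤ (Set.range v) = ⊤) :
    Topology.IsEmbedding (torusMap k v) := by
  refine ⟨⟨le_antisymm (continuous_torusMap v).le_induced (le_generateFrom ?_)⟩, fun s t hst =>
    Torus.ext_monomial fun m => torusMap_eq_iff.1 hst m (diffLattice_eq_top hv ▸ trivial)⟩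
  rintro _ ⟨f, rfl⟩
  obtain ⟨d, F, G, hF, -, hFG⟩ := isFormQuotient hv f
  refine ⟨_, isOpen_eval_ne_zero hF, Set.ext fun t => ?_⟩
  simp only [Set.mem_preimage, Set.mem_ofPred_eq, ne_eq, eval_rep_torusMap_eq_zero v t hF,
    (hFG t).2, div_eq_zero_iff, (hFG t).1, or_false]

theorem isDenseOpenIn_torusMap [IsAlgClosed k] [Finite ι] {v : ι → L}
    (hv : affineSpan ℤ (Set.range v) = ⊤) : IsDenseOpenIn (torusMap k v) (toricVariety k v) :=
  ⟨isEmbedding_torusMap hv, ⟨_, isOpen_forall_rep_ne_zero, range_torusMap v⟩, subset_rfl⟩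

end Toric

/-! ### Dimension -/

section Dimension

variable {k : Type*} [Field k] {L ι κ : Type*} [AddCommGroup L]

theorem isAlgebraic_adjoin_single_basis [Module.Free ℤ L] (b : Module.Basis ι ℤ L) :
    Algebra.IsAlgebraic
      (Algebra.adjoin k (Set.range fun i => AddMonoidAlgebra.single (b i) (1 : k)))
      (AddMonoidAlgebra k L) := by
  have := Torus.isDomain_addMonoidAlgebra (k := k) (M := L)
  set R := Algebra.adjoin k (Set.range fun i => AddMonoidAlgebra.single (b i) (1 : k))
  have hmul : ∀ m m' : L, AddMonoidAlgebra.single m (1 : k) * AddMonoidAlgebra.single m' 1 =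
      AddMonoidAlgebra.single (m + m') 1 := fun m m' => by simp
  have hsingle : ∀ m : L, IsAlgebraic R (AddMonoidAlgebra.single m (1 : k)) := fun m => by
    have hm : m ∈ AddSubgroup.closure (Set.range b) := by
      rw [← Submodule.span_int_eq_addSubgroupClosure, b.span_eq]
      exact trivial
    induction hm using AddSubgroup.closure_induction with
    | mem m hm =>
      obtain ⟨i, rfl⟩ := hm
      exact isAlgebraic_algebraMap (⟨_, Algebra.subset_adjoin ⟨i, rfl⟩⟩ : R)
    | zero => exact isAlgebraic_one
    | add m m' _ _ h h' => exact hmul m m' ▸ h.mul h'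
    | neg m _ h =>
      let inv : Invertible (AddMonoidAlgebra.single m (1 : k)) :=
        ⟨AddMonoidAlgebra.single (-m) 1, by simp [AddMonoidAlgebra.one_def],
          by simp [AddMonoidAlgebra.one_def]⟩
      exact h.invOf
  refine ⟨fun f => ?_⟩
  induction f using AddMonoidAlgebra.induction_linear with
  | zero => exact isAlgebraic_zero
  | add f g hf hg => exact hf.add hg
  | single m c =>
    have h : AddMonoidAlgebra.single m c = c • AddMonoidAlgebra.single m (1 : k) := by simp
    rw [h, ← algebraMap_smul R c]
    exact (hsingle m).smul (algebraMap k R c)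

theorem trdeg_addMonoidAlgebra_le [Module.Free ℤ L] [Module.Finite ℤ L] :
    Algebra.trdeg k (AddMonoidAlgebra k L) ≤ Module.finrank ℤ L := by
  have := Torus.isDomain_addMonoidAlgebra (k := k) (M := L)
  have := isAlgebraic_adjoin_single_basis (k := k) (Module.finBasis ℤ L)
  refine (Algebra.IsAlgebraic.trdeg_le_cardinalMk k (Set.range fun i =>
    AddMonoidAlgebra.single (Module.finBasis ℤ L i) (1 : k))).trans ?_
  simpa only [Cardinal.mk_fin, Cardinal.lift_natCast, Cardinal.lift_uzero] using
    Cardinal.mk_range_le_lift (f := fun i =>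
      AddMonoidAlgebra.single (Module.finBasis ℤ L i) (1 : k))

theorem ringKrullDim_le_of_injective {A : Type*} [CommRing A] [Nontrivial A] [Algebra k A]
    [Algebra.FiniteType k A] [Module.Free ℤ L] [Module.Finite ℤ L]
    (f : A →ₐ[k] AddMonoidAlgebra k L) (hf : Function.Injective f) :
    ringKrullDim A ≤ Module.finrank ℤ L := by
  obtain ⟨s, g, hg, hgi⟩ := exists_integral_inj_algHom_of_fg k A
  have hs : s ≤ Module.finrank ℤ L := by
    have hind : AlgebraicIndependent k fun i => f (g (MvPolynomial.X i)) := by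
      have hfg : MvPolynomial.aeval (fun i => f (g (MvPolynomial.X i))) = f.comp g :=
        MvPolynomial.algHom_ext fun i => by simp
      rw [AlgebraicIndependent, hfg]
      exact hf.comp hg
    simpa using hind.lift_cardinalMk_le_trdeg.trans (Cardinal.lift_le.2 trdeg_addMonoidAlgebra_le)
  have hAs : ringKrullDim A ≤ ringKrullDim (MvPolynomial (Fin s) k) := by
    refine Order.krullDim_le_of_strictMono (PrimeSpectrum.comap g.toRingHom) fun p q hpq => ?_
    algebraize [g.toRingHom]
    exact Ideal.IsIntegral.comap_lt_comap (R := MvPolynomial (Fin s) k) (A := A)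
      (I := p.asIdeal) (J := q.asIdeal) hpq
  refine hAs.trans ?_
  rw [MvPolynomial.ringKrullDim_of_isNoetherianRing, ringKrullDim_eq_zero_of_field]
  simpa using hs

/-- The ideal of the polynomials that vanish on the affine cone over `Z`. -/
def coneIdeal (Z : Set (ℙ k (ι → k))) : Ideal (MvPolynomial ι k) :=
  ⨅ x ∈ Z, RingHom.ker (lineRestrict x.rep)

theorem mem_coneIdeal {Z : Set (ℙ k (ι → k))} {f : MvPolynomial ι k} :
    f ∈ coneIdeal Z ↔ ∀ x ∈ Z, lineRestrict x.rep f = 0 := by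
  simp only [coneIdeal, Ideal.mem_iInf, RingHom.mem_ker]

theorem lineRestrict_eq_zero_iff {f : MvPolynomial ι k} {d : ℕ} (hf : f.IsHomogeneous d)
    (x : ι → k) : lineRestrict x f = 0 ↔ MvPolynomial.eval x f = 0 := by
  simp only [Polynomial.ext_iff, coeff_lineRestrict, Polynomial.coeff_zero,
    MvPolynomial.homogeneousComponent_of_mem hf, apply_ite (MvPolynomial.eval x), map_zero]
  simp

theorem isPrime_coneIdeal {Z : Set (ℙ k (ι → k))} (hZ : IsIrreducible Z) :
    (coneIdeal Z).IsPrime := by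
  refine Ideal.isPrime_iff.2 ⟨(Ideal.ne_top_iff_one _).2 fun h => ?_, fun {f g} hfg => ?_⟩
  · obtain ⟨x, hx⟩ := hZ.nonempty
    simpa using mem_coneIdeal.1 h x hx
  · simp only [mem_coneIdeal] at hfg ⊢
    by_contra! hne
    obtain ⟨⟨x, hx, hxf⟩, ⟨y, hy, hyg⟩⟩ := hne
    obtain ⟨z, hz, hzf, hzg⟩ := hZ.2 _ _ (isOpen_lineRestrict_ne_zero f)
      (isOpen_lineRestrict_ne_zero g) ⟨x, hx, hxf⟩ ⟨y, hy, hyg⟩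
    exact mul_ne_zero hzf hzg (by rw [← map_mul, hfg z hz])

theorem coneIdeal_lt_coneIdeal {Z Z' : Set (ℙ k (ι → k))} (hZ : IsClosed Z) (hlt : Z ⊂ Z') :
    coneIdeal Z' < coneIdeal Z := by
  refine SetLike.lt_iff_le_and_exists.2
    ⟨fun f hf => mem_coneIdeal.2 fun x hx => mem_coneIdeal.1 hf x (hlt.1 hx), ?_⟩
  obtain ⟨y, hy', hy⟩ := Set.exists_of_ssubset hlt
  rw [← hZ.closure_eq, mem_closure_iff_eval] at hy
  push Not at hy
  obtain ⟨d, f, hf, hfZ, hfy⟩ := hy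
  exact ⟨f, mem_coneIdeal.2 fun x hx => (lineRestrict_eq_zero_iff hf _).2 (hfZ x hx),
    fun h => hfy ((lineRestrict_eq_zero_iff hf _).1 (mem_coneIdeal.1 h y hy'))⟩

theorem coneIdeal_lt_ker_constantCoeff {Z : Set (ℙ k (ι → k))} (hZ : Z.Nonempty) :
    coneIdeal Z < RingHom.ker MvPolynomial.constantCoeff := by
  obtain ⟨x, hx⟩ := hZ
  obtain ⟨j, hj⟩ : ∃ j, x.rep j ≠ 0 := Function.ne_iff.1 x.rep_nonzero
  refine SetLike.lt_iff_le_and_exists.2 ⟨fun f hf => ?_, MvPolynomial.X j, by simp, fun h => hj ?_⟩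
  · have h0 := coeff_lineRestrict x.rep f 0
    rw [mem_coneIdeal.1 hf x hx] at h0
    simpa [MvPolynomial.homogeneousComponent_zero, MvPolynomial.constantCoeff_eq] using h0.symm
  · simpa using (lineRestrict_eq_zero_iff (MvPolynomial.isHomogeneous_X k j) _).1
      (mem_coneIdeal.1 h x hx)

/-- The cones over a chain of subvarieties, together with the vertex, form a chain which is
longer by one. -/
theorem length_add_one_le_finrank [Finite ι] [Module.Free ℤ L] [Module.Finite ℤ L]
    (Φ : MvPolynomial ι k →ₐ[k] AddMonoidAlgebra k L)
    (p : LTSeries (TopologicalSpace.IrreducibleCloseds (ℙ k (ι → k))))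
    (hp : RingHom.ker Φ ≤ coneIdeal (p.last : Set (ℙ k (ι → k)))) :
    p.length + 1 ≤ Module.finrank ℤ L := by
  have := Torus.isDomain_addMonoidAlgebra (k := k) (M := L)
  have hker : ∀ i, RingHom.ker Φ ≤ coneIdeal (p i : Set (ℙ k (ι → k))) := fun i f hf =>
    mem_coneIdeal.2 fun x hx => mem_coneIdeal.1 (hp hf) x (p.monotone (Fin.le_last i) hx)
  let q : LTSeries (PrimeSpectrum.zeroLocus (RingHom.ker Φ : Set (MvPolynomial ι k)))ᵒᵈ :=
    LTSeries.mk p.length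
      (fun i => OrderDual.toDual ⟨⟨_, isPrime_coneIdeal (p i).isIrreducible⟩, hker i⟩)
      fun i j hij => coneIdeal_lt_coneIdeal (p i).isClosed (p.strictMono hij)
  have hvertex := coneIdeal_lt_ker_constantCoeff p.head.isIrreducible.nonempty
  let q' := q.cons (OrderDual.toDual
    ⟨⟨_, RingHom.ker_isPrime MvPolynomial.constantCoeff⟩, (hker 0).trans hvertex.le⟩) hvertex
  have hq' : q'.length = p.length + 1 := congrArg (· + 1) (zero_add p.length)
  have h1 := Order.LTSeries.length_le_krullDim q'
  rw [hq', Order.krullDim_orderDual, ← ringKrullDim_quotient] at h1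
  have : Nontrivial (MvPolynomial ι k ⧸ RingHom.ker Φ) :=
    Ideal.Quotient.nontrivial_iff.2 (RingHom.ker_isPrime Φ.toRingHom).ne_top
  have h2 := ringKrullDim_le_of_injective (A := MvPolynomial ι k ⧸ RingHom.ker Φ)
    (Ideal.kerLiftAlg Φ) (Ideal.kerLiftAlg_injective Φ)
  exact_mod_cast h1.trans h2

section ToricCover

variable [Infinite k]

theorem ker_le_coneIdeal_image_toricVariety [Nonempty ι] [Fintype ι] (v : ι → L)
    {R : (ι → k) →ₗ[k] (κ → k)}
    (hR : Function.Injective R) :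
    RingHom.ker ((monomialSubst k (homogenize v)).comp (linearSubst R)) ≤
      coneIdeal (Projectivization.map R hR '' toricVariety k v) := fun f hf => by
  rw [mem_coneIdeal, Set.forall_mem_image]
  exact fun y hy => (lineRestrict_rep_map_eq_zero R hR f y).2
    (lineRestrict_eq_zero_of_mem_toricVariety hy hf)

theorem topologicalKrullDim_le_of_isInducing [Finite κ] [Module.Free ℤ L] [Module.Finite ℤ L]
    {T : Type*} [TopologicalSpace T] {f : T → ℙ k (κ → k)} (hf : Topology.IsInducing f)
    {σ : Type*} [Finite σ] {ι : σ → Type*} [∀ s, Nonempty (ι s)] [∀ s, Finite (ι s)]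
    (v : ∀ s, ι s → L) {R : ∀ s, (ι s → k) →ₗ[k] (κ → k)} (hR : ∀ s, Function.Injective (R s))
    (hT : ∀ x, ∃ s, f x ∈ Projectivization.map (R s) (hR s) '' toricVariety k (v s)) :
    topologicalKrullDim T ≤ Module.finrank ℤ L := by
  have := fun s => Fintype.ofFinite (ι s)
  refine iSup_le fun p => ?_
  let X : σ → Set (ℙ k (κ → k)) := fun s =>
    Projectivization.map (R s) (hR s) '' toricVariety k (v s)
  have hX : ∀ s, IsClosed (X s) := fun s =>
    (isClosedEmbedding_projectivizationMap (R s) (hR s)).isClosedMap _ isClosed_closure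
  let F := TopologicalSpace.IrreducibleCloseds.map f hf.continuous
  obtain ⟨_, hs, hsub⟩ := isIrreducible_iff_sUnion_isClosed.1 (F p.last).isIrreducible
    (Set.finite_range X).toFinset (by simpa using hX) (by
      rw [Set.Finite.coe_toFinset, Set.sUnion_range]
      refine closure_minimal ?_ (isClosed_iUnion_of_finite hX)
      rintro _ ⟨x, -, rfl⟩
      exact Set.mem_iUnion.2 (hT x))
  obtain ⟨s, rfl⟩ := (Set.Finite.mem_toFinset _).1 hs
  have h := length_add_one_le_finrank
    ((monomialSubst k (homogenize (v s))).comp (linearSubst (R s)))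
    (p.map F (TopologicalSpace.IrreducibleCloseds.map_strictMono_of_isInducing hf))
    fun g hg => mem_coneIdeal.2 fun x hx => mem_coneIdeal.1
      (ker_le_coneIdeal_image_toricVariety (v s) (hR s) hg) x (hsub (by simpa using hx))
  rw [Module.finrank_prod, Module.finrank_self, LTSeries.map_length] at h
  exact_mod_cast Nat.le_of_succ_le_succ h

end ToricCover

section Flag

variable {n : ℕ} (b : Module.Basis (Fin n) ℤ L)

variable (k) in
/-- The `j`-dimensional coordinate subtorus, on which all coordinates but the first `j` are `1`. -/
def coordSubtorus (j : ℕ) : Set (Torus k L) :=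
  {t | ∀ i : Fin n, j ≤ i → Torus.monomial (b i) t = 1}

theorem isClosed_coordSubtorus (j : ℕ) : IsClosed (coordSubtorus k b j) := by
  simp only [coordSubtorus, Set.ofPred_forall]
  exact isClosed_iInter fun i => isClosed_iInter fun _ => Torus.isClosed_monomial_eq _ _

theorem isIrreducible_coordSubtorus [Infinite k] [Module.Free ℤ L] [Module.Finite ℤ L] (j : ℕ) :
    IsIrreducible (coordSubtorus k b j) := by
  let trunc : L →ₗ[ℤ] L := b.constr ℤ fun i => if j ≤ i then 0 else b i
  have htrunc : ∀ i t, Torus.monomial (b i) (Torus.induced k trunc.toAddMonoidHom t) =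
      if j ≤ i then 1 else Torus.monomial (b i) t := fun i t => by
    rw [Torus.monomial_induced, LinearMap.toAddMonoidHom_coe, b.constr_basis]
    split_ifs
    exacts [Torus.monomial_zero t, rfl]
  have hrange : coordSubtorus k b j = Set.range (Torus.induced k trunc.toAddMonoidHom) := by
    ext t
    constructor
    · refine fun ht => ⟨t, Torus.ext_basis b fun i => ?_⟩
      rw [htrunc]
      split_ifs with hi
      exacts [(ht i hi).symm, rfl]
    · rintro ⟨s, rfl⟩ i hi
      rw [htrunc, if_pos hi]
  rw [hrange, ← Set.image_univ]
  exact Torus.isIrreducible_univ.image _ (Torus.continuous_induced _).continuousOn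

theorem coordSubtorus_ssubset [Infinite k] {i j : ℕ} (hij : i < j) (hj : j ≤ n) :
    coordSubtorus k b i ⊂ coordSubtorus k b j := by
  obtain ⟨a, ha⟩ := Torus.exists_zpow_ne_one (k := k) one_ne_zero
  let i' : Fin n := ⟨i, hij.trans_le hj⟩
  have hval := Torus.monomial_ofBasis_self b fun l => if l = i' then a else 1
  have hsub : coordSubtorus k b i ⊆ coordSubtorus k b j := fun t ht l hl => ht l (hij.le.trans hl)
  refine (Set.ssubset_iff_of_subset hsub).2
    ⟨Torus.ofBasis b fun l => if l = i' then a else 1, fun l hl => ?_, fun h => ha ?_⟩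
  · have hne : l ≠ i' := fun h => hij.not_ge (hl.trans (Fin.val_eq_of_eq h).le)
    rw [hval, if_neg hne, Units.val_one]
  · rw [zpow_one, ← Units.val_eq_one, ← h i' le_rfl, hval, if_pos rfl]

end Flag

theorem finrank_le_topologicalKrullDim_torus [Infinite k] [Module.Free ℤ L] [Module.Finite ℤ L] :
    (Module.finrank ℤ L : WithBot ℕ∞) ≤ topologicalKrullDim (Torus k L) := by
  let b := Module.finBasis ℤ L
  let Z : Fin (Module.finrank ℤ L + 1) → TopologicalSpace.IrreducibleCloseds (Torus k L) :=
    fun j => ⟨coordSubtorus k b j, isIrreducible_coordSubtorus b j, isClosed_coordSubtorus b j⟩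
  have hZ : StrictMono Z := fun i j hij => coordSubtorus_ssubset b hij (Nat.lt_succ_iff.1 j.2)
  exact Order.LTSeries.length_le_krullDim (LTSeries.mk _ Z hZ)

end Dimension

/-! ### Plücker coordinates -/

section Plucker

variable {k : Type*} [Field k] {n N : ℕ}

theorem pluckerVector_mul (C : Matrix (Fin (n + 1)) (Fin (n + 1)) k)
    (v : Fin (n + 1) → Fin (N + 1) → k) :
    pluckerVector (fun a => ∑ b, C a b • v b) = C.det • pluckerVector v := by
  funext I
  rw [Pi.smul_apply, smul_eq_mul, pluckerVector, pluckerVector, ← Matrix.det_mul]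
  congr 1
  ext a b
  simp [Matrix.mul_apply]

theorem Grassmannian.linearIndependent_basis (W : Grassmannian k n N) :
    LinearIndependent k fun a => (W.basis a : Fin (N + 1) → k) :=
  W.basis.linearIndependent.map' W.1.subtype (Submodule.ker_subtype _)

theorem plucker_eq_mk (W : Grassmannian k n N) {v : Fin (n + 1) → Fin (N + 1) → k}
    (hv : LinearIndependent k v) (hW : ∀ a, v a ∈ W.1) :
    plucker W = Projectivization.mk k (pluckerVector v) (pluckerVector_ne_zero hv) := by
  let C : Matrix (Fin (n + 1)) (Fin (n + 1)) k :=
    Matrix.of fun a b => W.basis.repr ⟨v a, hW a⟩ b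
  have hC : v = fun a => ∑ b, C a b • (W.basis b : Fin (N + 1) → k) := by
    funext a
    have h := congrArg W.1.subtype (W.basis.sum_repr ⟨v a, hW a⟩)
    rw [map_sum] at h
    exact h.symm
  have hvW : pluckerVector v = C.det • pluckerVector fun a => (W.basis a : Fin (N + 1) → k) :=
    (congrArg pluckerVector hC).trans (pluckerVector_mul C _)
  have hdet : C.det ≠ 0 := fun h => pluckerVector_ne_zero hv (by rw [hvW, h, zero_smul])
  rw [plucker, Projectivization.mk_eq_mk_iff']
  exact ⟨C.det⁻¹, by rw [hvW, smul_smul, inv_mul_cancel₀ hdet, one_smul]⟩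

theorem pluckerVector_ne_zero_iff {v : Fin (n + 1) → Fin (N + 1) → k} :
    pluckerVector v ≠ 0 ↔ LinearIndependent k v := by
  refine ⟨fun h => ?_, pluckerVector_ne_zero⟩
  obtain ⟨I, hI⟩ := Function.ne_iff.1 h
  exact .of_comp (LinearMap.funLeft k k I) (Matrix.linearIndependent_rows_of_det_ne_zero hI)

theorem pluckerVector_cons_apply (w : Fin (N + 1) → k) (v : Fin (n + 1) → Fin (N + 1) → k)
    (J : Fin (n + 2) ↪o Fin (N + 1)) :
    pluckerVector (Fin.cons w v) J =
      ∑ j : Fin (n + 2), (-1) ^ (j : ℕ) * w (J j) *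
        pluckerVector v (j.succAboveOrderEmb.trans J) := by
  rw [pluckerVector, Matrix.det_succ_row_zero]
  rfl

theorem pluckerVector_cons_eq_zero_iff (W : Grassmannian k n N) (w : Fin (N + 1) → k) :
    pluckerVector (Fin.cons w fun a => (W.basis a : Fin (N + 1) → k)) = 0 ↔ w ∈ W.1 := by
  have hspan : Submodule.span k (Set.range fun a => (W.basis a : Fin (N + 1) → k)) = W.1 := by
    refine Eq.trans ?_ (Submodule.map_subtype_top W.1)
    rw [← W.basis.span_eq, Submodule.map_span, ← Set.range_comp]
    rfl
  rw [← not_iff_not, ← ne_eq, pluckerVector_ne_zero_iff, linearIndependent_finCons, hspan,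
    and_iff_right W.linearIndependent_basis]

theorem plucker_injective : Function.Injective (plucker (k := k) (n := n) (N := N)) := by
  intro W W' h
  obtain ⟨c, hc⟩ := (Projectivization.mk_eq_mk_iff' k _ _ _ _).1 h
  have hc0 : c ≠ 0 := by
    rintro rfl
    exact pluckerVector_ne_zero W.linearIndependent_basis (hc.symm.trans (zero_smul k _))
  have hcons : ∀ w : Fin (N + 1) → k,
      pluckerVector (Fin.cons w fun a => (W.basis a : Fin (N + 1) → k)) =
        c • pluckerVector (Fin.cons w fun a => (W'.basis a : Fin (N + 1) → k)) := by
    intro w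
    funext J
    simp only [Pi.smul_apply, pluckerVector_cons_apply, ← hc, smul_eq_mul, Finset.mul_sum]
    exact Finset.sum_congr rfl fun j _ => by ring
  refine Subtype.ext (Submodule.ext fun w => ?_)
  rw [← pluckerVector_cons_eq_zero_iff, ← pluckerVector_cons_eq_zero_iff, hcons,
    smul_eq_zero_iff_right hc0]

end Plucker

/-! ### Embedded tangent spaces -/

section Gradient

variable {k : Type*} [Field k] {ι κ : Type*}

/-- The gradient of the polynomial `f` at the point `x`. -/
def gradient (f : MvPolynomial ι k) (x : ι → k) : ι → k :=
  fun i => MvPolynomial.eval x (MvPolynomial.pderiv i f)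

theorem gradient_smul_of_isHomogeneous {f : MvPolynomial ι k} {d : ℕ} (hf : f.IsHomogeneous d)
    (c : k) (x : ι → k) : gradient f (c • x) = c ^ (d - 1) • gradient f x :=
  funext fun _ => eval_smul_of_isHomogeneous hf.pderiv c x

/-- The `k[ε]`-point `x + ε w` of affine space. -/
def dualPoint (x w : ι → k) : ι → DualNumber k :=
  fun i => TrivSqZeroExt.inl (x i) + TrivSqZeroExt.inr (w i)

theorem aeval_dualPoint [Fintype ι] (f : MvPolynomial ι k) (x w : ι → k) :
    MvPolynomial.aeval (dualPoint x w) f =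
      (TrivSqZeroExt.inl (MvPolynomial.eval x f) + TrivSqZeroExt.inr (gradient f x ⬝ᵥ w) :
        DualNumber k) := by
  classical
  have hC : ∀ a : k, gradient (MvPolynomial.C a) x = 0 := fun a => funext fun i => by
    simp [gradient]
  have hX : ∀ l, gradient (MvPolynomial.X l) x = Pi.single l 1 := fun l => funext fun i => by
    simp [gradient, MvPolynomial.pderiv_X, Pi.single_apply, apply_ite, eq_comm]
  induction f using MvPolynomial.induction_on with
  | C a => simp [hC, TrivSqZeroExt.algebraMap_eq_inl]
  | add p q hp hq =>
    have hadd : gradient (p + q) x = gradient p x + gradient q x := funext fun i => by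
      simp [gradient]
    rw [map_add, hp, hq, map_add, hadd, add_dotProduct]
    ext <;> simp
  | mul_X p l hp =>
    have hmul : gradient (p * MvPolynomial.X l) x =
        x l • gradient p x + MvPolynomial.eval x p • Pi.single l 1 := by
      rw [← hX l]
      funext i
      simp [gradient, add_comm]
    rw [map_mul, hp, MvPolynomial.aeval_X, hmul, add_dotProduct, smul_dotProduct, smul_dotProduct,
      single_one_dotProduct]
    ext <;> simp [dualPoint, mul_comm, add_comm]

theorem aeval_dualPoint_eq_zero_iff [Fintype ι] {f : MvPolynomial ι k} {x w : ι → k}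
    (hx : MvPolynomial.eval x f = 0) :
    MvPolynomial.aeval (dualPoint x w) f = 0 ↔ gradient f x ⬝ᵥ w = 0 := by
  rw [aeval_dualPoint, hx]
  simp [TrivSqZeroExt.ext_iff]

theorem gradient_linearSubst_dotProduct [Fintype ι] [Fintype κ] (R : (ι → k) →ₗ[k] (κ → k))
    (f : MvPolynomial κ k) (x w : ι → k) :
    gradient (linearSubst R f) x ⬝ᵥ w = gradient f (R x) ⬝ᵥ R w := by
  classical
  have hpt : ∀ j, MvPolynomial.aeval (dualPoint x w) (linearSubst R (MvPolynomial.X j)) =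
      dualPoint (R x) (R w) j := by
    intro j
    rw [linearSubst, MvPolynomial.aeval_X, Matrix.toMvPolynomial, map_sum]
    have hR : ∀ v : ι → k, R v j = ∑ i, LinearMap.toMatrix' R j i * v i := fun v => by
      rw [← LinearMap.toMatrix'_mulVec]
      rfl
    simp only [dualPoint, hR, ← MvPolynomial.C_mul_X_eq_monomial, map_mul, MvPolynomial.aeval_C,
      MvPolynomial.aeval_X, TrivSqZeroExt.algebraMap_eq_inl]
    ext <;> simp [TrivSqZeroExt.fst_sum, TrivSqZeroExt.snd_sum]
  have hcomp : (MvPolynomial.aeval (dualPoint x w)).comp (linearSubst R) =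
      MvPolynomial.aeval (R := k) (dualPoint (R x) (R w)) :=
    MvPolynomial.algHom_ext fun j => by rw [MvPolynomial.aeval_X]; exact hpt j
  simpa [aeval_dualPoint] using congrArg TrivSqZeroExt.snd (DFunLike.congr_fun hcomp f)

end Gradient

section TangentSpace

variable {k : Type*} [Field k] {n N : ℕ}

theorem exists_mul_eq_one_of_linearIndependent_row {m : Type*} [Finite m] [DecidableEq m]
    {ι : Type*} [Fintype ι] {A : Matrix m ι k} (hA : LinearIndependent k A.row) :
    ∃ s : Matrix ι m k, A * s = 1 := by
  have := Fintype.ofFinite m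
  rw [← Matrix.mulVec_surjective_iff_exists_right_inverse, ← Matrix.coe_mulVecLin,
    ← LinearMap.range_eq_top]
  refine Submodule.eq_top_of_finrank_eq ?_
  rw [Module.finrank_fintype_fun_eq_card]
  exact hA.rank_matrix

theorem adjugate_mulVec_mem {m : Type*} [Fintype m] [DecidableEq m] {A : Matrix m m k}
    (hA : A.det ≠ 0) {S T : Submodule k (m → k)} (hST : ∀ w ∈ S, A.mulVec w ∈ T)
    (hrank : Module.finrank k S = Module.finrank k T) {w : m → k} (hw : w ∈ T) :
    A.adjugate.mulVec w ∈ S := by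
  have hmap : S.map A.mulVecLin = T := by
    refine Submodule.eq_of_le_of_finrank_eq (Submodule.map_le_iff_le_comap.2 hST) ?_
    rw [← hrank]
    exact (Submodule.equivMapOfInjective _
      (Matrix.mulVec_injective_of_det_ne_zero hA) S).finrank_eq.symm
  obtain ⟨w, hwS, rfl⟩ := hmap.symm ▸ hw
  rw [Matrix.mulVecLin_apply, Matrix.mulVec_mulVec, Matrix.adjugate_mul, Matrix.smul_mulVec,
    Matrix.one_mulVec]
  exact S.smul_mem _ hwS

/-- A polynomial family of endomorphisms, the identity at `y`, that maps all tangent spaces of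
`X` into the one at `y`: correct the identity by the variation of finitely many equations whose
gradients at `y` are a basis of the conormal space. -/
theorem exists_matrix_mulVec_mem_embeddedTangentSpace (X : Set (ℙ k (Fin (N + 1) → k)))
    (y : ℙ k (Fin (N + 1) → k)) :
    ∃ P : Matrix (Fin (N + 1)) (Fin (N + 1)) (MvPolynomial (Fin (N + 1)) k),
      P.map (MvPolynomial.eval y.rep) = 1 ∧
      ∀ (z : ℙ k (Fin (N + 1) → k)) (c : k), ∀ w ∈ embeddedTangentSpace X z,
        (P.map (MvPolynomial.eval (c • z.rep))).mulVec w ∈ embeddedTangentSpace X y := by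
  classical
  obtain ⟨b, hb, hspan, hli⟩ := exists_linearIndependent k {g | ∃ (d : ℕ)
    (f : MvPolynomial (Fin (N + 1)) k), f.IsHomogeneous d ∧
      (∀ z ∈ X, MvPolynomial.eval z.rep f = 0) ∧ gradient f y.rep = g}
  have : Fintype b := hli.setFinite.fintype
  choose d F hF hFX hFy using fun g : b => hb g.2
  let G (x : Fin (N + 1) → k) : Matrix b (Fin (N + 1)) k := .of fun g => gradient (F g) x
  have hT : ∀ w, (G y.rep).mulVec w = 0 → w ∈ embeddedTangentSpace X y := by
    intro w hw e f hf hfX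
    have hmem : gradient f y.rep ∈ Submodule.span k b :=
      hspan ▸ Submodule.subset_span ⟨e, f, hf, hfX, rfl⟩
    have hle : Submodule.span k b ≤ LinearMap.ker ((dotProductBilin k k).flip w) :=
      Submodule.span_le.2 fun g hg => by
        have h : gradient (F ⟨g, hg⟩) y.rep ⬝ᵥ w = 0 := congrFun hw ⟨g, hg⟩
        rwa [hFy] at h
    exact hle hmem
  obtain ⟨s, hs⟩ := exists_mul_eq_one_of_linearIndependent_row (A := G y.rep)
    (by rwa [show (G y.rep).row = Subtype.val from funext hFy])
  let P : Matrix (Fin (N + 1)) (Fin (N + 1)) (MvPolynomial (Fin (N + 1)) k) :=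
    .of fun i j => MvPolynomial.C ((1 : Matrix _ _ k) i j) + ∑ g, MvPolynomial.C (s i g) *
      (MvPolynomial.pderiv j (F g) - MvPolynomial.C (G y.rep g j))
  have hP : ∀ x, P.map (MvPolynomial.eval x) = 1 + s * (G x - G y.rep) := by
    intro x
    ext i j
    simp [P, G, gradient, Matrix.mul_apply]
  refine ⟨P, by simp [hP], fun z c w hw => hT _ ?_⟩
  rw [Matrix.mulVec_mulVec, hP, Matrix.mul_add, Matrix.mul_one, ← Matrix.mul_assoc, hs,
    Matrix.one_mul, add_sub_cancel]
  funext g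
  change gradient (F g) (c • z.rep) ⬝ᵥ w = 0
  rw [gradient_smul_of_isHomogeneous (hF g), smul_dotProduct]
  exact smul_eq_zero_of_right _ (hw _ _ (hF g) (hFX g))

theorem exists_eval_eq_det_mul_eval_pluckerVector
    (P : Matrix (Fin (N + 1)) (Fin (N + 1)) (MvPolynomial (Fin (N + 1)) k))
    (w : Fin (n + 1) → Fin (N + 1) → k)
    (G : MvPolynomial (Fin (n + 1) ↪o Fin (N + 1)) k) :
    ∃ H : MvPolynomial (Fin (N + 1)) k, ∀ x, MvPolynomial.eval x H =
      (P.map (MvPolynomial.eval x)).det * MvPolynomial.eval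
        (pluckerVector fun a => (P.map (MvPolynomial.eval x)).adjugate.mulVec (w a)) G := by
  refine ⟨P.det * MvPolynomial.aeval (fun J : Fin (n + 1) ↪o Fin (N + 1) =>
    Matrix.det (.of fun a b => P.adjugate.mulVec (MvPolynomial.C ∘ w a) (J b))) G, fun x => ?_⟩
  have hadj : ∀ a, MvPolynomial.eval x ∘ P.adjugate.mulVec (MvPolynomial.C ∘ w a) =
      (P.map (MvPolynomial.eval x)).adjugate.mulVec (w a) := by
    intro a
    funext i
    rw [Function.comp_apply, RingHom.map_mulVec, ← RingHom.mapMatrix_apply, RingHom.map_adjugate]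
    congr 2
    funext j
    exact MvPolynomial.eval_C _
  rw [map_mul, RingHom.map_det, MvPolynomial.aeval_def, MvPolynomial.eval_eval₂]
  congr 1
  rw [← MvPolynomial.eval₂_id]
  congr 1
  · ext; simp
  · funext J
    rw [RingHom.map_det, pluckerVector]
    congr 1
    ext a b
    exact congrFun (hadj a) (J b)

theorem continuous_plucker_gaussMap [Infinite k] {X : Set (ℙ k (Fin (N + 1) → k))}
    (hX : topologicalKrullDim X = n) :
    Continuous fun x : smoothLocus X => plucker (gaussMap X hX x) := by
  refine continuous_generateFrom_iff.2 ?_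
  rintro _ ⟨d, G, hG, rfl⟩
  refine isOpen_iff_forall_mem_open.2 fun y (hy : MvPolynomial.eval (plucker _).rep G ≠ 0) => ?_
  obtain ⟨P, hPy, hP⟩ := exists_matrix_mulVec_mem_embeddedTangentSpace X y.1
  let w := fun a => ((gaussMap X hX y).basis a : Fin (N + 1) → k)
  obtain ⟨H, hH⟩ := exists_eval_eq_det_mul_eval_pluckerVector P w G
  have hHy : MvPolynomial.eval y.1.rep H ≠ 0 := by
    rw [plucker_eq_mk _ (gaussMap X hX y).linearIndependent_basis fun a => Subtype.prop _, Ne,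
      eval_rep_mk_eq_zero hG] at hy
    simpa [hH, hPy] using hy
  refine ⟨{z | lineRestrict z.1.rep H ≠ 0}, fun z hz => ?_,
    (isOpen_lineRestrict_ne_zero H).preimage continuous_subtype_val, fun h => hHy ?_⟩
  · obtain ⟨c, hc⟩ : ∃ c : k, MvPolynomial.eval (c • z.1.rep) H ≠ 0 := by
      by_contra! h
      exact hz (Polynomial.funext fun c => by rw [eval_lineRestrict, h, Polynomial.eval_zero])
    rw [hH] at hc
    have hdet := left_ne_zero_of_mul hc
    have hmem : ∀ a, (P.map (MvPolynomial.eval (c • z.1.rep))).adjugate.mulVec (w a) ∈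
        (gaussMap X hX z).1 := fun a =>
      adjugate_mulVec_mem hdet (hP z.1 c) ((gaussMap X hX z).2.trans (gaussMap X hX y).2.symm)
        ((gaussMap X hX y).basis a).2
    have hli : LinearIndependent k fun a =>
        (P.map (MvPolynomial.eval (c • z.1.rep))).adjugate.mulVec (w a) := by
      refine (gaussMap X hX y).linearIndependent_basis.map' (Matrix.mulVecLin _)
        (LinearMap.ker_eq_bot.2 (Matrix.mulVec_injective_of_det_ne_zero ?_))
      rw [Matrix.det_adjugate]
      exact pow_ne_zero _ hdet
    rw [Set.mem_preimage, Set.mem_ofPred_eq, plucker_eq_mk _ hli hmem, Ne, eval_rep_mk_eq_zero hG]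
    exact right_ne_zero_of_mul hc
  · simpa [h] using (eval_lineRestrict y.1.rep H 1).symm

end TangentSpace

section Homogenization

theorem prodMk_one_mem_span_iff {R V ι : Type*} [Ring R] [Nontrivial R] [AddCommGroup V]
    [Module R V] {p : ι → V} {x : V} :
    (x, (1 : R)) ∈ Submodule.span R (Set.range fun i => (p i, (1 : R))) ↔
      x ∈ affineSpan R (Set.range p) := by
  rw [mem_affineSpan_iff_eq_affineCombination, Finsupp.mem_span_range_iff_exists_finsupp]
  constructor
  · rintro ⟨c, hc⟩
    have h1 : ∑ i ∈ c.support, c i = 1 := by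
      simpa [Finsupp.sum, Prod.snd_sum] using congrArg Prod.snd hc
    refine ⟨c.support, c, h1, ?_⟩
    rw [Finset.affineCombination_eq_linear_combination _ _ _ h1]
    simpa [Finsupp.sum, Prod.fst_sum] using (congrArg Prod.fst hc).symm
  · rintro ⟨s, w, hw, rfl⟩
    rw [Finset.affineCombination_eq_linear_combination _ _ _ hw,
      ← Finsupp.mem_span_range_iff_exists_finsupp]
    have h : (∑ i ∈ s, w i • p i, (1 : R)) = ∑ i ∈ s, w i • (p i, (1 : R)) := by
      simp [Prod.ext_iff, Prod.fst_sum, Prod.snd_sum, hw]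
    rw [h]
    exact Submodule.sum_smul_mem _ _ fun i _ => Submodule.subset_span ⟨i, rfl⟩

theorem span_prodMk_one_eq_top_iff {R V ι : Type*} [Ring R] [Nontrivial R] [AddCommGroup V]
    [Module R V] [Nonempty ι] {p : ι → V} :
    Submodule.span R (Set.range fun i => (p i, (1 : R))) = ⊤ ↔
      affineSpan R (Set.range p) = ⊤ := by
  constructor
  · exact fun h => eq_top_iff.2 fun x _ => prodMk_one_mem_span_iff.1 (h ▸ Submodule.mem_top)
  · refine fun h => eq_top_iff.2 fun ⟨x, c⟩ _ => ?_
    obtain ⟨i⟩ := ‹Nonempty ι›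
    have hx : (x, c) = (x - (c - 1) • p i, 1) + (c - 1) • (p i, (1 : R)) := by
      simp
    rw [hx]
    exact add_mem (prodMk_one_mem_span_iff.2 (h ▸ AffineSubspace.mem_top R V _))
      (Submodule.smul_mem _ _ (Submodule.subset_span ⟨i, rfl⟩))

theorem span_homogenize_eq_top {L ι : Type*} [AddCommGroup L] [Nonempty ι] {v : ι → L}
    (hv : affineSpan ℤ (Set.range v) = ⊤) :
    Submodule.span ℤ (Set.range (homogenize v)) = ⊤ :=
  span_prodMk_one_eq_top_iff.2 hv

theorem exists_addMonoidHom_apply_eq {L G ι : Type*} [AddCommGroup L] [AddCommGroup G]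
    {w : ι → L} (hw : Submodule.span ℤ (Set.range w) = ⊤) {x : ι → G}
    (h : ∀ m, Finsupp.linearCombination ℤ w m = 0 → Finsupp.linearCombination ℤ x m = 0) :
    ∃ ℓ : L →+ G, ∀ i, ℓ (w i) = x i := by
  have hsurj : Function.Surjective (Finsupp.linearCombination ℤ w).toAddMonoidHom :=
    LinearMap.range_eq_top.1 ((Finsupp.range_linearCombination ℤ).trans hw)
  let ℓ := AddMonoidHom.liftOfSurjective _ hsurj
    ⟨(Finsupp.linearCombination ℤ x).toAddMonoidHom, h⟩
  refine ⟨ℓ, fun i => ?_⟩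
  have hi : (Finsupp.linearCombination ℤ w).toAddMonoidHom (Finsupp.single i 1) = w i := by simp
  rw [← hi, AddMonoidHom.liftOfRightInverse_comp_apply]
  simp

end Homogenization

section ToricTangent

variable {k : Type*} [Field k] {M : Type*} [AddCommGroup M] {n N : ℕ}

theorem mem_embeddedTangentSpace_iff_of_smul {X : Set (ℙ k (Fin (N + 1) → k))}
    {y : ℙ k (Fin (N + 1) → k)} {c : k} (hc : c ≠ 0) {w : Fin (N + 1) → k} :
    w ∈ embeddedTangentSpace X y ↔ ∀ (d : ℕ) (f : MvPolynomial (Fin (N + 1)) k),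
      f.IsHomogeneous d → (∀ z ∈ X, MvPolynomial.eval z.rep f = 0) →
        gradient f (c • y.rep) ⬝ᵥ w = 0 := by
  refine forall_congr' fun d => forall_congr' fun f => imp_congr_right fun hf =>
    imp_congr_right fun _ => ?_
  rw [gradient_smul_of_isHomogeneous hf, smul_dotProduct, smul_eq_mul, mul_eq_zero,
    or_iff_right (pow_ne_zero _ hc)]
  rfl

theorem mem_embeddedTangentSpace_mk {X : Set (ℙ k (Fin (N + 1) → k))} {v : Fin (N + 1) → k}
    (hv : v ≠ 0) {w : Fin (N + 1) → k} :
    w ∈ embeddedTangentSpace X (Projectivization.mk k v hv) ↔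
      ∀ (d : ℕ) (f : MvPolynomial (Fin (N + 1)) k), f.IsHomogeneous d →
        (∀ z ∈ X, MvPolynomial.eval z.rep f = 0) → gradient f v ⬝ᵥ w = 0 := by
  obtain ⟨c, hc⟩ := Projectivization.exists_smul_eq_mk_rep k v hv
  rw [mem_embeddedTangentSpace_iff_of_smul (c⁻¹.ne_zero), ← hc, ← Units.smul_def, inv_smul_smul]

theorem map_embeddedTangentSpace_le (X : Set (ℙ k (Fin (N + 1) → k)))
    {R : (Fin (N + 1) → k) →ₗ[k] (Fin (N + 1) → k)} (hR : Function.Injective R)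
    (y : ℙ k (Fin (N + 1) → k)) :
    (embeddedTangentSpace X y).map R ≤
      embeddedTangentSpace (Projectivization.map R hR '' X) (Projectivization.map R hR y) := by
  induction y using Projectivization.ind with | h v hv => ?_
  rintro _ ⟨w, hw, rfl⟩
  refine (mem_embeddedTangentSpace_mk _).2 fun d f hf hX => ?_
  rw [← gradient_linearSubst_dotProduct]
  exact (mem_embeddedTangentSpace_mk hv).1 hw d _ (isHomogeneous_linearSubst R hf) fun z hz =>
    (eval_rep_map_eq_zero R hR hf z).1 (hX _ ⟨z, hz, rfl⟩)

theorem embeddedTangentSpace_map (X : Set (ℙ k (Fin (N + 1) → k)))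
    (g : (Fin (N + 1) → k) ≃ₗ[k] (Fin (N + 1) → k)) (y : ℙ k (Fin (N + 1) → k)) :
    embeddedTangentSpace (Projectivization.map g.toLinearMap g.injective '' X)
        (Projectivization.map g.toLinearMap g.injective y) =
      (embeddedTangentSpace X y).map g.toLinearMap := by
  have hinv (z : ℙ k (Fin (N + 1) → k)) : Projectivization.map g.symm.toLinearMap g.symm.injective
      (Projectivization.map g.toLinearMap g.injective z) = z := by
    induction z using Projectivization.ind with
    | h v hv => simp [Projectivization.map_mk]
  refine le_antisymm ?_ (map_embeddedTangentSpace_le X g.injective y)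
  have h := map_embeddedTangentSpace_le (Projectivization.map g.toLinearMap g.injective '' X)
    g.symm.injective (Projectivization.map g.toLinearMap g.injective y)
  simp only [Set.image_image, hinv, Set.image_id'] at h
  rwa [Submodule.map_le_iff_le_comap, ← Submodule.map_equiv_eq_comap_symm] at h

theorem gradient_monomial_dotProduct {ι : Type*} [Fintype ι] (a : ι →₀ ℕ) (x y : ι → k) :
    gradient (MvPolynomial.monomial a 1) x ⬝ᵥ (x * y) =
      (a.prod fun i e => x i ^ e) * Finsupp.linearCombination ℕ y a := by
  have h : ∀ i, gradient (MvPolynomial.monomial a 1) x i * x i =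
      a i * a.prod fun i e => x i ^ e := fun i => by
    have hi := congrArg (MvPolynomial.eval x)
      (MvPolynomial.X_mul_pderiv_monomial (R := k) (i := i) (m := a) (r := 1))
    simpa [gradient, MvPolynomial.eval_monomial, mul_comm] using hi
  rw [Finsupp.linearCombination_apply, Finsupp.sum_fintype _ _ (by simp), Finset.mul_sum]
  refine Finset.sum_congr rfl fun i _ => ?_
  rw [Pi.mul_apply, ← mul_assoc, h, nsmul_eq_mul]
  ring

/-- The `k[ε]`-point `z^m ↦ z^m(t) (1 + ε ℓ(m))` of the torus: the tangent vector `ℓ` at `t`. -/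
def dualTorusPoint {L : Type*} [AddCommGroup L] (t : Torus k L) (ℓ : L →+ k) :
    AddMonoidAlgebra k L →ₐ[k] DualNumber k :=
  AddMonoidAlgebra.lift k (DualNumber k) L
    { toFun := fun m => TrivSqZeroExt.inl (Torus.monomial m.toAdd t) +
        TrivSqZeroExt.inr (Torus.monomial m.toAdd t * ℓ m.toAdd)
      map_one' := by simp [Torus.monomial_zero]
      map_mul' := fun m m' => by
        ext <;> simp [Torus.monomial_add]
        ring }

theorem dualTorusPoint_comp_monomialSubst {L ι : Type*} [AddCommGroup L] (w : ι → L)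
    (t : Torus k L) (ℓ : L →+ k) : (dualTorusPoint t ℓ).comp (monomialSubst k w) =
      MvPolynomial.aeval (dualPoint (fun i => Torus.monomial (w i) t)
        ((fun i => Torus.monomial (w i) t) * ℓ ∘ w)) :=
  MvPolynomial.algHom_ext fun i => by
    simp [monomialSubst, dualTorusPoint, dualPoint]

theorem monomialSubst_homogenize_eq_zero [Infinite k] [Module.Free ℤ M] [Module.Finite ℤ M]
    {ι : Type*} [Nonempty ι] {u : ι → M} {f : MvPolynomial ι k} {d : ℕ} (hf : f.IsHomogeneous d)
    (hX : ∀ y ∈ toricVariety k u, MvPolynomial.eval y.rep f = 0) :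
    monomialSubst k (homogenize u) f = 0 :=
  Torus.eq_zero_of_eval_eq_zero fun t => by
    let s := Torus.induced k (AddMonoidHom.inl M ℤ) t
    have hs := (eval_rep_torusMap_eq_zero u s hf).1 (hX _ (subset_closure ⟨s, rfl⟩))
    have h := eval_smul_of_isHomogeneous hf (Torus.monomial (0, 1) t)
      fun i => Torus.monomial (u i) s
    rw [hs, mul_zero] at h
    rw [eval_monomialSubst, ← h]
    exact congrArg (MvPolynomial.eval · f) (funext fun i => monomial_homogenize u i t)

theorem degree_eq_of_linearCombination_homogenize_eq {L ι : Type*} [AddCommGroup L] {v : ι → L}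
    {a b : ι →₀ ℕ} (hab : Finsupp.linearCombination ℕ (homogenize v) a =
      Finsupp.linearCombination ℕ (homogenize v) b) : a.degree = b.degree := by
  have h := congrArg Prod.snd hab
  simp only [Finsupp.linearCombination_apply, Finsupp.sum, Prod.snd_sum, Prod.smul_snd, homogenize,
    nsmul_eq_mul, mul_one] at h
  exact_mod_cast h

theorem linearCombination_eq_of_mem_embeddedTangentSpace [Infinite k] {u : Fin (N + 1) → M}
    {t : Torus k M} {y : Fin (N + 1) → k}
    (hy : (fun i => Torus.monomial (u i) t) * y ∈
      embeddedTangentSpace (toricVariety k u) (torusMap k u t))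
    {a b : Fin (N + 1) →₀ ℕ} (hab : Finsupp.linearCombination ℕ (homogenize u) a =
      Finsupp.linearCombination ℕ (homogenize u) b) :
    Finsupp.linearCombination ℕ y a = Finsupp.linearCombination ℕ y b := by
  set x : Fin (N + 1) → k := fun i => Torus.monomial (u i) t
  let f : MvPolynomial (Fin (N + 1)) k := MvPolynomial.monomial a 1 - MvPolynomial.monomial b 1
  have hf : f.IsHomogeneous a.degree := (MvPolynomial.isHomogeneous_monomial 1 rfl).sub
    (MvPolynomial.isHomogeneous_monomial 1 (degree_eq_of_linearCombination_homogenize_eq hab).symm)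
  have hX : ∀ z ∈ toricVariety k u, MvPolynomial.eval z.rep f = 0 := fun z hz => by
    rw [map_sub, sub_eq_zero, MvPolynomial.eval_monomial, MvPolynomial.eval_monomial, one_mul,
      one_mul, prod_rep_pow_eq_of_mem_toricVariety hz hab]
  have hpow : (a.prod fun i e => x i ^ e) = b.prod fun i e => x i ^ e := by
    have h := (eval_rep_torusMap_eq_zero u t hf).1 (hX _ (subset_closure ⟨t, rfl⟩))
    rwa [map_sub, sub_eq_zero, MvPolynomial.eval_monomial, MvPolynomial.eval_monomial, one_mul,
      one_mul] at h
  have hgrad : gradient f x =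
      gradient (MvPolynomial.monomial a 1) x - gradient (MvPolynomial.monomial b 1) x :=
    funext fun i => by simp [f, gradient]
  have h := (mem_embeddedTangentSpace_mk _).1 hy _ f hf hX
  rw [hgrad, sub_dotProduct, gradient_monomial_dotProduct, gradient_monomial_dotProduct, ← hpow,
    ← mul_sub] at h
  exact sub_eq_zero.1 ((mul_eq_zero.1 h).resolve_left
    (Finset.prod_ne_zero_iff.2 fun i _ => pow_ne_zero _ (Torus.monomial_ne_zero (u i) t)))

theorem mem_embeddedTangentSpace_torusMap_iff [Infinite k] [Module.Free ℤ M] [Module.Finite ℤ M]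
    {u : Fin (N + 1) → M} (hu : affineSpan ℤ (Set.range u) = ⊤) {t : Torus k M}
    {w : Fin (N + 1) → k} :
    w ∈ embeddedTangentSpace (toricVariety k u) (torusMap k u t) ↔
      ∃ ℓ : M × ℤ →+ k, ∀ i, w i = Torus.monomial (u i) t * ℓ (homogenize u i) := by
  constructor
  · intro hw
    obtain ⟨y, rfl⟩ : ∃ y, w = (fun i => Torus.monomial (u i) t) * y :=
      ⟨fun i => w i / Torus.monomial (u i) t, funext fun i =>
        (mul_div_cancel₀ (w i) (Torus.monomial_ne_zero (u i) t)).symm⟩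
    obtain ⟨ℓ, hℓ⟩ := exists_addMonoidHom_apply_eq (span_homogenize_eq_top hu) fun m hm =>
      linearCombination_eq_zero_of_nat
        (fun a b => linearCombination_eq_of_mem_embeddedTangentSpace hw (a := a) (b := b)) hm
    exact ⟨ℓ, fun i => by rw [hℓ]; rfl⟩
  · rintro ⟨ℓ, hw⟩
    refine (mem_embeddedTangentSpace_mk _).2 fun d f hf hX => ?_
    let T := Torus.induced k (AddMonoidHom.fst M ℤ) t
    have hT : (fun i => Torus.monomial (homogenize u i) T) = fun i => Torus.monomial (u i) t := rfl
    have hwx : w = (fun i => Torus.monomial (homogenize u i) T) * ℓ ∘ homogenize u := funext hw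
    have hf0 := monomialSubst_homogenize_eq_zero hf hX
    have hfx := (eval_rep_torusMap_eq_zero u t hf).1 (hX _ (subset_closure ⟨t, rfl⟩))
    rw [← aeval_dualPoint_eq_zero_iff hfx, hwx, ← hT, ← dualTorusPoint_comp_monomialSubst,
      AlgHom.comp_apply, hf0, map_zero]

end ToricTangent

section CoordMatrix

variable {k : Type*} [Field k] {L ι m : Type*} [AddCommGroup L]

variable (k) in
/-- The matrix over `k` of the coordinates of the lattice points `v_j` in a basis of the
lattice. -/
def coordMatrix (β : Module.Basis m ℤ L) (v : ι → L) : Matrix m ι k :=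
  Matrix.of fun a j => (β.repr (v j) a : k)

variable (β : Module.Basis m ℤ L)

theorem sum_mul_coordMatrix [Fintype m] (ℓ : L →+ k) (v : ι → L) (j : ι) :
    ∑ a, ℓ (β a) * coordMatrix k β v a j = ℓ (v j) := by
  conv_rhs => rw [← β.sum_repr (v j), map_sum]
  exact Finset.sum_congr rfl fun a _ => by simp [coordMatrix, mul_comm]

theorem linearIndependent_coordMatrix_row [Finite m] {v : ι → L}
    (hv : Submodule.span ℤ (Set.range v) = ⊤) :
    LinearIndependent k (coordMatrix k β v).row := by
  have := Fintype.ofFinite m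
  refine Fintype.linearIndependent_iff.2 fun g hg a => ?_
  let ℓ : L →ₗ[ℤ] k := β.constr ℤ g
  have hβ : ∀ a, ℓ (β a) = g a := β.constr_basis ℤ g
  have hℓ : ∀ j, ℓ (v j) = 0 := fun j => by
    have hj := congrFun hg j
    rw [← ℓ.toAddMonoidHom_coe, ← sum_mul_coordMatrix β]
    simpa [hβ, Finset.sum_apply, Matrix.row] using hj
  have hℓ0 : ℓ = 0 := LinearMap.ext_on_range hv hℓ
  rw [← hβ, hℓ0, LinearMap.zero_apply]

theorem span_tmul_eq_top_iff [Fintype m] [DecidableEq m] (v : m → L) :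
    Submodule.span k (Set.range fun j => (1 : k) ⊗ₜ[ℤ] v j) = ⊤ ↔ (coordMatrix k β v).det ≠ 0 := by
  let e := Algebra.TensorProduct.basis k β
  have he : e.toMatrix (fun j => (1 : k) ⊗ₜ[ℤ] v j) = coordMatrix k β v := by
    ext a j
    simp [e, coordMatrix, Module.Basis.toMatrix_apply, Algebra.TensorProduct.basis_repr_tmul]
  rw [← isUnit_iff_ne_zero, ← he, ← e.det_apply, ← Module.Basis.is_basis_iff_det,
    iff_and_self]
  exact fun h => linearIndependent_of_top_le_span_of_card_eq_finrank h.ge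
    (Module.finrank_eq_card_basis e).symm

end CoordMatrix

section SpanningSums

variable {k : Type*} [Field k] {M : Type*} [AddCommGroup M] {n N : ℕ}
  (β : Module.Basis (Fin (n + 1)) ℤ (M × ℤ))

variable (k) in
/-- The determinant of the homogeneous coordinates of `n + 1` points of the `n`-dimensional
lattice `M`. -/
def coordMinor (p : Fin (n + 1) → M) : k :=
  (coordMatrix k β (homogenize p)).det

theorem affineSpan_tmul_eq_top_iff (p : Fin (n + 1) → M) :
    affineSpan k (Set.range fun j => (1 : k) ⊗ₜ[ℤ] p j) = ⊤ ↔ coordMinor k β p ≠ 0 := by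
  let e : k ⊗[ℤ] (M × ℤ) ≃ₗ[k] (k ⊗[ℤ] M) × k :=
    TensorProduct.prodRight ℤ k k M ℤ ≪≫ₗ
      (LinearEquiv.refl k _).prodCongr (TensorProduct.AlgebraTensorModule.rid ℤ k k)
  have he : (fun j => ((1 : k) ⊗ₜ[ℤ] p j, (1 : k))) =
      e ∘ fun j => (1 : k) ⊗ₜ[ℤ] homogenize p j := funext fun j => by
    simp [e, homogenize]
  rw [coordMinor, ← span_tmul_eq_top_iff, ← span_prodMk_one_eq_top_iff, he, Set.range_comp,
    ← LinearEquiv.coe_coe, ← Submodule.map_span, Submodule.map_eq_top_iff]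

theorem mem_spanningSums {ι : Type*} {u : ι → M} {b : M} :
    b ∈ spanningSums k u n ↔
      ∃ J : Fin (n + 1) → ι, coordMinor k β (u ∘ J) ≠ 0 ∧ b = ∑ j, u (J j) := by
  simp only [spanningSums, Set.mem_ofPred_eq, ← affineSpan_tmul_eq_top_iff, Function.comp_apply]

theorem finite_spanningSums {ι : Type*} [Finite ι] (u : ι → M) : (spanningSums k u n).Finite := by
  refine (Set.finite_range fun J : Fin (n + 1) → ι => ∑ j, u (J j)).subset ?_
  rintro _ ⟨J, -, rfl⟩
  exact ⟨J, rfl⟩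

theorem coordMinor_comp_perm (p : Fin (n + 1) → M) (σ : Equiv.Perm (Fin (n + 1))) :
    coordMinor k β (p ∘ σ) = Equiv.Perm.sign σ * coordMinor k β p :=
  Matrix.det_permute' σ (coordMatrix k β (homogenize p))

theorem injective_of_coordMinor_ne_zero {p : Fin (n + 1) → M} (hp : coordMinor k β p ≠ 0) :
    Function.Injective p := fun a b hab => by
  by_contra hne
  exact hp (Matrix.det_zero_of_column_eq hne fun c => by simp [coordMatrix, homogenize, hab])

theorem exists_orderEmbedding_of_coordMinor_ne_zero {u : Fin (N + 1) → M}
    {J : Fin (n + 1) → Fin (N + 1)} (hJ : coordMinor k β (u ∘ J) ≠ 0) :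
    ∃ I : Fin (n + 1) ↪o Fin (N + 1),
      coordMinor k β (u ∘ I) ≠ 0 ∧ ∑ j, u (I j) = ∑ j, u (J j) := by
  have hs : StrictMono (J ∘ Tuple.sort J) := (Tuple.monotone_sort J).strictMono_of_injective
    ((injective_of_coordMinor_ne_zero β hJ).of_comp.comp (Tuple.sort J).injective)
  refine ⟨OrderEmbedding.ofStrictMono _ hs, ?_, Equiv.sum_comp (Tuple.sort J) fun j => u (J j)⟩
  rw [OrderEmbedding.coe_ofStrictMono, ← Function.comp_assoc, coordMinor_comp_perm]
  exact mul_ne_zero (((Units.isUnit _).map (Int.castRingHom k)).ne_zero) hJ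

variable (u : Fin (N + 1) → M)

/-- The rows of coordinates, scaled by the monomials `z^{u_j}(t)`: a basis of the tangent space of
`X_A` at the point `t` of the torus. -/
def tangentRows (t : Torus k M) : Fin (n + 1) → Fin (N + 1) → k :=
  fun a j => Torus.monomial (u j) t * coordMatrix k β (homogenize u) a j

theorem pluckerVector_tangentRows (t : Torus k M) (I : Fin (n + 1) ↪o Fin (N + 1)) :
    pluckerVector (tangentRows β u t) I =
      Torus.monomial (∑ j, u (I j)) t * coordMinor k β (u ∘ I) := by
  rw [Torus.monomial_sum, coordMinor, ← Matrix.det_mul_row]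
  rfl

variable {u} (hu : affineSpan ℤ (Set.range u) = ⊤)
include hu

theorem linearIndependent_tangentRows (t : Torus k M) :
    LinearIndependent k (tangentRows β u t) := by
  have h := (linearIndependent_coordMatrix_row (k := k) β (span_homogenize_eq_top hu)).map'
    (LinearMap.mulLeft k fun j => Torus.monomial (u j) t) (LinearMap.ker_eq_bot.2 ?_)
  · exact h
  · intro x y hxy
    funext j
    exact mul_left_cancel₀ (Torus.monomial_ne_zero (u j) t) (congrFun hxy j)

theorem embeddedTangentSpace_torusMap [Infinite k] [Module.Free ℤ M] [Module.Finite ℤ M]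
    (t : Torus k M) : embeddedTangentSpace (toricVariety k u) (torusMap k u t) =
      Submodule.span k (Set.range (tangentRows β u t)) := by
  ext w
  rw [mem_embeddedTangentSpace_torusMap_iff hu, Submodule.mem_span_range_iff_exists_fun]
  constructor
  · rintro ⟨ℓ, hℓ⟩
    refine ⟨fun a => ℓ (β a), funext fun j => ?_⟩
    rw [hℓ, ← sum_mul_coordMatrix β, Finset.mul_sum, Finset.sum_apply]
    exact Finset.sum_congr rfl fun a _ => mul_left_comm _ _ _
  · rintro ⟨g, rfl⟩
    refine ⟨(β.constr ℤ g).toAddMonoidHom, fun j => ?_⟩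
    rw [← sum_mul_coordMatrix β, Finset.mul_sum, Finset.sum_apply]
    exact Finset.sum_congr rfl fun a _ => by simp [tangentRows, mul_left_comm]

end SpanningSums

/-! ### Saturated sublattices and their tori -/

section Saturation

variable {M : Type*} [AddCommGroup M]

theorem diffLattice_le_realSaturation (S : Set M) : diffLattice S ≤ realSaturation S :=
  (AddSubgroup.closure_le _).2 fun _ hx => Submodule.subset_span ⟨_, hx, rfl⟩

theorem exists_dual_apply_ne_zero [Module.Finite ℤ M] {D : Submodule ℤ M} {m : M}
    (hm : ∀ e : ℤ, e ≠ 0 → e • m ∉ D) :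
    ∃ c : M →ₗ[ℤ] ℤ, D ≤ LinearMap.ker c ∧ c m ≠ 0 := by
  let q : M →ₗ[ℤ] (M ⧸ D) ⧸ Submodule.torsion ℤ (M ⧸ D) := (Submodule.mkQ _).comp D.mkQ
  have hq : q m ≠ 0 := by
    intro h
    obtain ⟨⟨e, he⟩, he'⟩ := (Submodule.mem_torsion_iff _).1 ((Submodule.Quotient.mk_eq_zero _).1 h)
    exact hm e (nonZeroDivisors.ne_zero he) ((Submodule.Quotient.mk_eq_zero D).1 he')
  let b := Module.Free.chooseBasis ℤ ((M ⧸ D) ⧸ Submodule.torsion ℤ (M ⧸ D))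
  obtain ⟨i, hi⟩ : ∃ i, b.coord i (q m) ≠ 0 := by
    by_contra! h
    exact hq (b.forall_coord_eq_zero_iff.1 h)
  refine ⟨(b.coord i).comp q, fun x hx => ?_, hi⟩
  have hx0 : D.mkQ x = 0 := (Submodule.Quotient.mk_eq_zero D).2 hx
  simp only [q, LinearMap.mem_ker, LinearMap.comp_apply, hx0, map_zero]

theorem mem_realSaturation_iff [Module.Finite ℤ M] {S : Set M} {m : M} :
    m ∈ realSaturation S ↔ ∃ e : ℤ, e ≠ 0 ∧ e • m ∈ diffLattice S := by
  constructor
  · intro hm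
    by_contra! h
    obtain ⟨c, hc, hcm⟩ := exists_dual_apply_ne_zero (D := (diffLattice S).toIntSubmodule) h
    let F : ℝ ⊗[ℤ] M →ₗ[ℝ] ℝ := ((Algebra.linearMap ℤ ℝ).comp c).liftBaseChange ℝ
    have hF : ∀ x, F (1 ⊗ₜ x) = c x := fun x => by simp [F]
    have hspan :
        Submodule.span ℝ ((fun m : M => (1 : ℝ) ⊗ₜ[ℤ] m) '' (S - S)) ≤ LinearMap.ker F := by
      rw [Submodule.span_le]
      rintro _ ⟨x, hx, rfl⟩
      exact (hF x).trans (Int.cast_eq_zero.2 (hc (AddSubgroup.subset_closure hx)))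
    exact hcm (Int.cast_eq_zero.1 ((hF m).symm.trans (hspan hm)))
  · rintro ⟨e, he, hm⟩
    have h : (1 : ℝ) ⊗ₜ[ℤ] (e • m) ∈ Submodule.span ℝ ((fun m : M => (1 : ℝ) ⊗ₜ[ℤ] m) '' (S - S)) :=
      diffLattice_le_realSaturation S hm
    have h' : (e : ℝ)⁻¹ • ((1 : ℝ) ⊗ₜ[ℤ] (e • m)) = (1 : ℝ) ⊗ₜ[ℤ] m := by
      rw [TensorProduct.tmul_smul, ← Int.cast_smul_eq_zsmul ℝ,
        inv_smul_smul₀ (Int.cast_ne_zero.2 he)]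
    exact (congrArg (· ∈ Submodule.span ℝ _) h').mp (Submodule.smul_mem _ (e : ℝ)⁻¹ h)

theorem isTorsionFree_quotient_realSaturation [Module.Finite ℤ M] (S : Set M) :
    Module.IsTorsionFree ℤ (M ⧸ realSaturation S) := by
  refine Module.IsTorsionFree.of_smul_eq_zero fun c x hx => ?_
  obtain ⟨m, rfl⟩ := QuotientAddGroup.mk_surjective x
  refine or_iff_not_imp_left.2 fun hc => (QuotientAddGroup.eq_zero_iff m).2 ?_
  obtain ⟨e, he, hem⟩ := mem_realSaturation_iff.1 ((QuotientAddGroup.eq_zero_iff (c • m)).1 hx)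
  exact mem_realSaturation_iff.2 ⟨e * c, mul_ne_zero he hc, by rwa [mul_smul]⟩

theorem finite_quotient [Module.Finite ℤ M] (H : AddSubgroup M) : Module.Finite ℤ (M ⧸ H) :=
  Module.Finite.of_surjective (QuotientAddGroup.mk' H).toIntLinearMap
    (QuotientAddGroup.mk'_surjective H)

theorem exists_zsmul_mem_diffLattice [Module.Finite ℤ M] (S : Set M) :
    ∃ e : ℤ, e ≠ 0 ∧ ∀ m ∈ realSaturation S, e • m ∈ diffLattice S := by
  let D := (diffLattice S).toIntSubmodule
  let Q := (realSaturation S).toIntSubmodule.map D.mkQ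
  have hQ : Module.IsTorsion ℤ Q := by
    rintro ⟨_, m, hm, rfl⟩
    obtain ⟨e, he, hem⟩ := mem_realSaturation_iff.1 hm
    exact ⟨⟨e, mem_nonZeroDivisors_of_ne_zero he⟩,
      Subtype.ext ((Submodule.Quotient.mk_eq_zero D).2 hem)⟩
  obtain ⟨e, heQ, he⟩ := (Set.nonempty_def.1 (Submodule.annihilator_top_inter_nonZeroDivisors hQ))
  refine ⟨e, nonZeroDivisors.ne_zero he, fun m hm => (Submodule.Quotient.mk_eq_zero D).1 ?_⟩
  exact congrArg Subtype.val
    (Submodule.mem_annihilator.1 heQ (⟨D.mkQ m, m, hm, rfl⟩ : Q) Submodule.mem_top)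

theorem finrank_quotient_realSaturation [Module.Finite ℤ M] (S : Set M) :
    Module.finrank ℤ (M ⧸ realSaturation S) + Module.finrank ℤ (diffLattice S) =
      Module.finrank ℤ M := by
  let D := (diffLattice S).toIntSubmodule
  let H := (realSaturation S).toIntSubmodule
  have htors : H.map D.mkQ ≤ Submodule.torsion ℤ (M ⧸ D) := by
    rintro _ ⟨m, hm, rfl⟩
    obtain ⟨e, he, hem⟩ := mem_realSaturation_iff.1 hm
    exact (Submodule.mem_torsion_iff _).2 ⟨⟨e, mem_nonZeroDivisors_of_ne_zero he⟩,
      (Submodule.Quotient.mk_eq_zero D).2 hem⟩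
  have hle : D ≤ H := diffLattice_le_realSaturation S
  have hquot : Module.finrank ℤ (M ⧸ H) = Module.finrank ℤ (M ⧸ D) :=
    (Submodule.quotientQuotientEquivQuotient D H hle).finrank_eq.symm.trans
      (finrank_quotient_eq_of_le_torsion htors)
  rw [← D.finrank_quotient_add_finrank, ← hquot]
  rfl

end Saturation

section Coset

variable {k : Type*} [Field k] {M : Type*} [AddCommGroup M]

theorem finite_torus_zpow_eq_one [Module.Finite ℤ M] {e : ℤ} (he : e ≠ 0) :
    {t : Torus k M | t ^ e = 1}.Finite := by
  obtain ⟨g, hg⟩ := Module.Finite.fg_top (R := ℤ) (M := M)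
  have : NeZero e.natAbs := ⟨Int.natAbs_ne_zero.2 he⟩
  let ρ : {t : Torus k M | t ^ e = 1} → g → rootsOfUnity e.natAbs k := fun t x =>
    ⟨t.1 (Multiplicative.ofAdd x.1), (pow_natAbs_eq_one).2 (DFunLike.congr_fun t.2 _)⟩
  have hρ : Function.Injective ρ := by
    intro t t' h
    refine Subtype.ext (MonoidHom.toAdditiveRight.injective (AddMonoidHom.toIntLinearMap_injective
      (LinearMap.ext_on hg fun x hx => ?_)))
    exact congrArg Subtype.val (congrFun h ⟨x, hx⟩)
  exact Finite.of_injective ρ hρ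

theorem mem_range_induced_mk' {H : AddSubgroup M} {t : Torus k M} :
    t ∈ Set.range (Torus.induced k (QuotientAddGroup.mk' H)) ↔
      ∀ m ∈ H, Torus.monomial m t = 1 := by
  constructor
  · rintro ⟨s, rfl⟩ m hm
    rw [Torus.monomial_induced, QuotientAddGroup.mk'_apply, (QuotientAddGroup.eq_zero_iff m).2 hm,
      Torus.monomial_zero]
  · intro ht
    exact ⟨AddMonoidHom.toMultiplicativeLeft (QuotientAddGroup.lift H (MonoidHom.toAdditiveRight t)
      fun m hm => Additive.toMul.injective (Units.ext (ht m hm))), Torus.ext_monomial fun _ => rfl⟩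

theorem mul_image_range_induced_mk' (H : AddSubgroup M) (s : Torus k M) :
    (s * ·) '' Set.range (Torus.induced k (QuotientAddGroup.mk' H)) =
      {t | ∀ m ∈ H, Torus.monomial m t = Torus.monomial m s} := by
  ext t
  refine (Set.ext_iff.1 (Set.image_mul_left (a := s)) t).trans (mem_range_induced_mk'.trans ?_)
  refine forall₂_congr fun m _ => ?_
  rw [Torus.monomial_mul, Torus.monomial_inv, inv_mul_eq_one₀ (Torus.monomial_ne_zero m s), eq_comm]

theorem isClosed_setOf_monomial_eq (H : AddSubgroup M) (s : Torus k M) :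
    IsClosed {t : Torus k M | ∀ m ∈ H, Torus.monomial m t = Torus.monomial m s} := by
  simp only [Set.ofPred_forall]
  exact isClosed_biInter fun m _ => Torus.isClosed_monomial_eq m _

theorem isIrreducible_setOf_monomial_eq [Infinite k] [Module.Finite ℤ M] {H : AddSubgroup M}
    [Module.IsTorsionFree ℤ (M ⧸ H)] (s : Torus k M) :
    IsIrreducible {t : Torus k M | ∀ m ∈ H, Torus.monomial m t = Torus.monomial m s} := by
  have := finite_quotient H
  rw [← mul_image_range_induced_mk', ← Set.image_univ, Set.image_image]
  exact Torus.isIrreducible_univ.image _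
    ((Torus.continuous_mul_left s).comp (Torus.continuous_induced _)).continuousOn

theorem exists_finite_cosets [Module.Finite ℤ M] (S : Set M) (s : Torus k M) :
    ∃ R : Set (Torus k M), R.Finite ∧
      {t | ∀ m ∈ diffLattice S, Torus.monomial m t = Torus.monomial m s} =
        ⋃ r ∈ R, {t | ∀ m ∈ realSaturation S, Torus.monomial m t = Torus.monomial m r} := by
  obtain ⟨e, he, hem⟩ := exists_zsmul_mem_diffLattice S
  let ρ : Torus k M →* Torus k (realSaturation S) := Torus.induced k (realSaturation S).subtype
  let K : Set (Torus k M) := {t | ∀ m ∈ diffLattice S, Torus.monomial m t = Torus.monomial m s}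
  have hρ : ∀ t r, ρ t = ρ r ↔ ∀ m ∈ realSaturation S, Torus.monomial m t = Torus.monomial m r :=
    fun t r => ⟨fun h m hm => congrArg (Torus.monomial (⟨m, hm⟩ : realSaturation S)) h,
      fun h => Torus.ext_monomial fun m => h m m.2⟩
  have hfin : (ρ '' K).Finite := by
    have : Module.Finite ℤ (realSaturation S) :=
      inferInstanceAs (Module.Finite ℤ (realSaturation S).toIntSubmodule)
    refine ((finite_torus_zpow_eq_one he).image (ρ s * ·)).subset ?_
    rintro _ ⟨t, ht, rfl⟩
    refine ⟨(ρ s)⁻¹ * ρ t, Torus.ext_monomial fun m => ?_, mul_inv_cancel_left (ρ s) (ρ t)⟩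
    have hzpow (x : Torus k (realSaturation S)) :
        Torus.monomial m (x ^ e) = Torus.monomial (e • m) x := by simp [Torus.monomial]
    have hst : Torus.monomial (e • m) (ρ t) = Torus.monomial (e • m) (ρ s) := ht _ (hem m m.2)
    rw [hzpow, Torus.monomial_mul, Torus.monomial_inv, hst,
      inv_mul_cancel₀ (Torus.monomial_ne_zero _ _), Torus.monomial_one]
  obtain ⟨R, hRK, hR⟩ := Set.exists_subset_bijOn K ρ
  refine ⟨R, (hR.image_eq ▸ hfin).of_finite_image hR.injOn, Set.ext fun t => ?_⟩
  simp only [Set.mem_iUnion, Set.mem_ofPred_eq, exists_prop, ← hρ]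
  constructor
  · intro ht
    obtain ⟨r, hr, hrt⟩ := hR.surjOn ⟨t, ht, rfl⟩
    exact ⟨r, hr, hrt.symm⟩
  · rintro ⟨r, hr, hrt⟩ m hm
    exact ((hρ t r).1 hrt m (diffLattice_le_realSaturation S hm)).trans (hRK hr m hm)

end Coset

theorem exists_image_val_eq_of_mem_irreducibleComponents {X I : Type*} [TopologicalSpace X]
    {P : Set X} {s : Set I} (hs : s.Finite) {Z : I → Set X} (hclosed : ∀ i ∈ s, IsClosed (Z i))
    (hirred : ∀ i ∈ s, IsIrreducible (Z i)) (hP : P = ⋃ i ∈ s, Z i) {C : Set P}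
    (hC : C ∈ irreducibleComponents P) : ∃ i ∈ s, Subtype.val '' C = Z i := by
  classical
  have hZP : ∀ i ∈ s, Z i ⊆ P := fun i hi => hP ▸ Set.subset_biUnion_of_mem hi
  obtain ⟨_, hmem, hCZ⟩ := isIrreducible_iff_sUnion_isClosed.1
    (hC.1.image Subtype.val continuous_subtype_val.continuousOn) (hs.image Z).toFinset
    (by simpa using hclosed) (by
      rintro _ ⟨x, _, rfl⟩
      simpa [hP] using x.2)
  obtain ⟨i, hi, rfl⟩ : ∃ i ∈ s, Z i = _ := by simpa using hmem
  refine ⟨i, hi, hCZ.antisymm ?_⟩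
  have := isIrreducible_iff_irreducibleSpace.1 (hirred i hi)
  have hirred' : IsIrreducible (Subtype.val ⁻¹' Z i : Set P) := by
    have h := (IrreducibleSpace.isIrreducible_univ (Z i)).image _
      (continuous_inclusion (hZP i hi)).continuousOn
    rwa [Set.image_univ, Set.range_inclusion] at h
  exact fun x hx => ⟨⟨x, hZP i hi hx⟩, hC.2 hirred' (Set.image_subset_iff.1 hCZ) hx, rfl⟩

/-! ### Monomial linear embeddings -/

section LinearEmbedding

variable {k : Type*} [Field k] {ι κ : Type*}

/-- The linear map `y ↦ (c_i y_{σ i})_i`. It carries torus orbits to torus orbits. -/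
def weightedPullback (c : ι → k) (σ : ι → κ) : (κ → k) →ₗ[k] (ι → k) :=
  LinearMap.pi fun i => c i • LinearMap.proj (σ i)

theorem weightedPullback_injective {c : ι → k} {σ : ι → κ} (h : ∀ j, ∃ i, σ i = j ∧ c i ≠ 0) :
    Function.Injective (weightedPullback c σ) := by
  intro y z hyz
  funext j
  obtain ⟨i, rfl, hi⟩ := h j
  exact mul_left_cancel₀ hi (congrFun hyz i)

theorem map_weightedPullback_torusMap {L : Type*} [AddCommGroup L] [Nonempty κ] {c : ι → k}
    {σ : ι → κ} (h : ∀ j, ∃ i, σ i = j ∧ c i ≠ 0) (v : κ → L) (t : Torus k L) {x : ι → k}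
    (hx : x ≠ 0) (hxc : ∀ i, x i = c i * Torus.monomial (v (σ i)) t) :
    Projectivization.map (weightedPullback c σ) (weightedPullback_injective h) (torusMap k v t) =
      Projectivization.mk k x hx := by
  rw [torusMap, Projectivization.map_mk]
  congr 1
  exact funext fun i => (hxc i).symm

theorem exists_projectiveEquivalence_of_map [Finite ι] [Nonempty κ] (R : (κ → k) →ₗ[k] (ι → k))
    (hR : Function.Injective R) {X : Set (ℙ k (ι → k))} {Y : Set (ℙ k (κ → k))}
    (hXY : X = Projectivization.map R hR '' Y) :
    ∃ e : ProjectiveEquivalence X Y, ∀ y,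
      Projectivization.map e.left e.left_injective (Projectivization.map R hR y) =
        Projectivization.map e.right e.right_injective y := by
  have : Nonempty ι := by
    by_contra! h
    have := hR.subsingleton
    exact false_of_nontrivial_of_subsingleton (κ → k)
  have hcard : Nat.card ι = (Nat.card ι - 1) + 1 := (Nat.sub_add_cancel Nat.card_pos).symm
  let ε : (ι → k) ≃ₗ[k] (Fin (Nat.card ι - 1 + 1) → k) :=
    LinearEquiv.funCongrLeft k k (Finite.equivFinOfCardEq hcard).symm
  have hcomp : ∀ y, Projectivization.map ε.toLinearMap ε.injective (Projectivization.map R hR y) =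
      Projectivization.map (ε.toLinearMap ∘ₗ R) (ε.injective.comp hR) y := fun y =>
    (congrFun (Projectivization.map_comp R hR ε.toLinearMap ε.injective) y).symm
  refine ⟨⟨Nat.card ι - 1, ε.toLinearMap, ε.toLinearMap ∘ₗ R, ε.injective, ε.injective.comp hR,
    ?_⟩, hcomp⟩
  rw [hXY, Set.image_image]
  exact Set.image_congr fun y _ => hcomp y

end LinearEmbedding

/-! ### The orbit of a toric variety -/

section Orbit

variable {k : Type*} [Field k] {M : Type*} [AddCommGroup M]

/-- The exponents `b - b₀`, `b ∈ S`, that define the orbit map of `X_S`. -/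
def orbitExponent {S : Set M} (b₀ b : S) : diffLattice S :=
  ⟨b.1 - b₀.1, AddSubgroup.subset_closure (Set.sub_mem_sub b.2 b₀.2)⟩

theorem affineSpan_orbitExponent {S : Set M} (b₀ : S) :
    affineSpan ℤ (Set.range (orbitExponent b₀)) = ⊤ := by
  have : Nonempty S := ⟨b₀⟩
  rw [AffineSubspace.affineSpan_eq_top_iff_vectorSpan_eq_top_of_nonempty _ _ _
    (Set.range_nonempty _), eq_top_iff]
  rintro ⟨x, hx⟩ -
  induction hx using AddSubgroup.closure_induction with
  | mem x hx =>
    obtain ⟨b, hb, b', hb', rfl⟩ := hx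
    have h := vsub_mem_vectorSpan ℤ (Set.mem_range_self (f := orbitExponent b₀) ⟨b, hb⟩)
      (Set.mem_range_self ⟨b', hb'⟩)
    exact (congrArg (· ∈ vectorSpan ℤ _) (Subtype.ext (sub_sub_sub_cancel_right b b' b₀.1))).mp h
  | zero => exact zero_mem _
  | add x y hx hy h h' => exact add_mem h h'
  | neg x hx h => exact neg_mem h

theorem induced_subtype_surjective [IsAlgClosed k] (H : AddSubgroup M) :
    Function.Surjective (Torus.induced k H.subtype) := fun s =>
  Torus.exists_induced_eq H.subtype s fun m hm => by
    rw [show m = 0 from Subtype.ext hm, Torus.monomial_zero]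

theorem torusMap_eq_orbitMap (S : Set M) [Nonempty S] (b₀ : S) (t : Torus k M) :
    torusMap k (Subtype.val : S → M) t =
      orbitMap k S b₀ (Torus.induced k (diffLattice S).subtype t) := by
  rw [torusMap, orbitMap, Projectivization.mk_eq_mk_iff']
  refine ⟨Torus.monomial b₀.1 t, funext fun b => ?_⟩
  rw [Pi.smul_apply, smul_eq_mul, Torus.monomial_induced, AddSubgroup.subtype_apply,
    Torus.monomial_sub, mul_div_cancel₀ _ (Torus.monomial_ne_zero _ _)]

theorem isDenseOpenIn_orbitMap [IsAlgClosed k] (S : Set M) [Finite S] [Nonempty S] (b₀ : S) :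
    IsDenseOpenIn (orbitMap k S b₀) (toricVarietyOfSet k S) := by
  have hrange : Set.range (torusMap k (Subtype.val : S → M)) = Set.range (orbitMap k S b₀) := by
    rw [funext (torusMap_eq_orbitMap (k := k) S b₀)]
    exact (induced_subtype_surjective (diffLattice S)).range_comp (orbitMap k S b₀)
  have hX : toricVarietyOfSet k S = toricVariety k (orbitExponent b₀) := congrArg closure hrange
  rw [hX]
  exact isDenseOpenIn_torusMap (affineSpan_orbitExponent b₀)

end Orbit

/-! ### The Gauss map of a toric variety -/

section GaussMap

variable {k : Type*} [Field k] {M : Type*} [AddCommGroup M] {n N : ℕ}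

theorem gaussImage_eq_closure_range [Infinite k] {X : Set (ℙ k (Fin (N + 1) → k))}
    (hX : topologicalKrullDim X = n) {T : Type*} {f : T → ℙ k (Fin (N + 1) → k)}
    (hf : ∀ t, f t ∈ smoothLocus X) (hdense : X ⊆ closure (Set.range f)) :
    gaussImage X hX = closure (Set.range fun t => plucker (gaussMap X hX ⟨f t, hf t⟩)) := by
  let g : T → smoothLocus X := fun t => ⟨f t, hf t⟩
  have hg : DenseRange g := fun x => closure_subtype.2 <| by
    rw [← Set.range_comp]
    exact hdense x.2.1
  refine Set.Subset.antisymm (closure_minimal ?_ isClosed_closure) (closure_mono ?_)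
  · rw [Set.range_comp' (fun x => plucker (gaussMap X hX x)) g]
    exact (continuous_plucker_gaussMap hX).range_subset_closure_image_dense hg
  · exact Set.range_comp_subset_range g fun x => plucker (gaussMap X hX x)

/-- A basis of the lattice `M × ℤ` of homogenized exponents. -/
def homogeneousBasis [Module.Free ℤ M] [Module.Finite ℤ M] (hn : Module.finrank ℤ M = n) :
    Module.Basis (Fin (n + 1)) ℤ (M × ℤ) :=
  Module.finBasisOfFinrankEq ℤ (M × ℤ) (by rw [Module.finrank_prod, Module.finrank_self, hn])

theorem exists_linearMap_pluckerVector_tangentRows (β : Module.Basis (Fin (n + 1)) ℤ (M × ℤ))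
    (u : Fin (N + 1) → M) [Nonempty (spanningSums k u n)] :
    ∃ R : (spanningSums k u n → k) →ₗ[k] ((Fin (n + 1) ↪o Fin (N + 1)) → k),
      Function.Injective R ∧
      ∀ t, pluckerVector (tangentRows β u t) = R fun b => Torus.monomial b.1 t := by
  classical
  let σ : (Fin (n + 1) ↪o Fin (N + 1)) → spanningSums k u n := fun I =>
    if h : coordMinor k β (u ∘ I) ≠ 0 then ⟨∑ j, u (I j), (mem_spanningSums β).2 ⟨I, h, rfl⟩⟩
    else Classical.arbitrary _
  have hσ : ∀ b, ∃ I, σ I = b ∧ coordMinor k β (u ∘ I) ≠ 0 := by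
    rintro ⟨b, hb⟩
    obtain ⟨J, hJ, rfl⟩ := (mem_spanningSums β).1 hb
    obtain ⟨I, hI, hIJ⟩ := exists_orderEmbedding_of_coordMinor_ne_zero β hJ
    exact ⟨I, by simp only [σ, dif_pos hI, hIJ], hI⟩
  refine ⟨weightedPullback (fun I => coordMinor k β (u ∘ I)) σ, weightedPullback_injective hσ,
    fun t => funext fun I => ?_⟩
  rw [pluckerVector_tangentRows, mul_comm]
  change _ = coordMinor k β (u ∘ I) * Torus.monomial (σ I).1 t
  by_cases hI : coordMinor k β (u ∘ I) = 0
  · rw [hI, zero_mul, zero_mul]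
  · simp only [σ, dif_pos hI]

variable {u : Fin (N + 1) → M} (hu : affineSpan ℤ (Set.range u) = ⊤)
include hu

theorem topologicalKrullDim_toricVariety [Infinite k] [Module.Free ℤ M] [Module.Finite ℤ M] :
    topologicalKrullDim (toricVariety k u) = Module.finrank ℤ M := by
  refine le_antisymm ?_ ?_
  · exact topologicalKrullDim_le_of_isInducing Topology.IsInducing.subtypeVal (fun _ : Unit => u)
      (R := fun _ => LinearMap.id) (fun _ => Function.injective_id)
      fun x => ⟨(), x, x.2, congrFun Projectivization.map_id _⟩
  · have h := (isEmbedding_torusMap (k := k) hu).isInducing.codRestrict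
      (s := toricVariety k u) fun t => subset_closure ⟨t, rfl⟩
    exact finrank_le_topologicalKrullDim_torus.trans h.topologicalKrullDim_le

variable [Module.Free ℤ M] [Module.Finite ℤ M]

theorem nonempty_spanningSums (k : Type*) [Field k] (hn : Module.finrank ℤ M = n) :
    (spanningSums k u n).Nonempty := by
  let β := homogeneousBasis hn
  obtain ⟨I, hI⟩ := Function.ne_iff.1
    (pluckerVector_ne_zero (linearIndependent_tangentRows β hu (1 : Torus k M)))
  rw [pluckerVector_tangentRows] at hI
  exact ⟨_, (mem_spanningSums β).2 ⟨I, right_ne_zero_of_mul hI, rfl⟩⟩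

variable [Infinite k]

theorem finrank_embeddedTangentSpace_torusMap (hn : Module.finrank ℤ M = n) (t : Torus k M) :
    Module.finrank k (embeddedTangentSpace (toricVariety k u) (torusMap k u t)) = n + 1 := by
  rw [embeddedTangentSpace_torusMap (homogeneousBasis hn) hu,
    finrank_span_eq_card (linearIndependent_tangentRows _ hu t), Fintype.card_fin]

theorem torusMap_mem_smoothLocus (t : Torus k M) :
    torusMap k u t ∈ smoothLocus (toricVariety k u) := by
  refine ⟨subset_closure ⟨t, rfl⟩, ?_⟩
  rw [topologicalKrullDim_toricVariety hu, finrank_embeddedTangentSpace_torusMap hu rfl t]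
  norm_cast

theorem exists_linearMap_plucker_gaussMap_torusMap (hn : Module.finrank ℤ M = n)
    [Nonempty (spanningSums k u n)] (hX : topologicalKrullDim (toricVariety k u) = n) :
    ∃ (R : (spanningSums k u n → k) →ₗ[k] ((Fin (n + 1) ↪o Fin (N + 1)) → k))
      (hR : Function.Injective R),
      ∀ t, plucker (gaussMap (toricVariety k u) hX
          ⟨torusMap k u t, torusMap_mem_smoothLocus hu t⟩) =
        Projectivization.map R hR (torusMap k (Subtype.val : spanningSums k u n → M) t) := by
  let β := homogeneousBasis hn
  obtain ⟨R, hR, hRt⟩ := exists_linearMap_pluckerVector_tangentRows (k := k) β u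
  refine ⟨R, hR, fun t => ?_⟩
  have hmem : ∀ a, tangentRows β u t a ∈ embeddedTangentSpace (toricVariety k u) (torusMap k u t) :=
    fun a => embeddedTangentSpace_torusMap β hu t ▸ Submodule.subset_span ⟨a, rfl⟩
  rw [plucker_eq_mk _ (linearIndependent_tangentRows β hu t) hmem]
  simp only [hRt]
  rfl

theorem gaussMap_torusMap_eq_iff (hn : Module.finrank ℤ M = n)
    (hX : topologicalKrullDim (toricVariety k u) = n) (s t : Torus k M) :
    gaussMap (toricVariety k u) hX ⟨torusMap k u s, torusMap_mem_smoothLocus hu s⟩ =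
        gaussMap (toricVariety k u) hX ⟨torusMap k u t, torusMap_mem_smoothLocus hu t⟩ ↔
      ∀ m ∈ diffLattice (spanningSums k u n), Torus.monomial m s = Torus.monomial m t := by
  have := (nonempty_spanningSums hu k hn).to_subtype
  obtain ⟨R, hR, hRφ⟩ := exists_linearMap_plucker_gaussMap_torusMap (k := k) hu hn hX
  rw [← plucker_injective.eq_iff, hRφ, hRφ, (Projectivization.map_injective R hR).eq_iff,
    torusMap_eq_iff, Subtype.range_coe]

theorem exists_projectiveEquivalence_gaussImage
    (hn : Module.finrank ℤ M = n) [Nonempty (spanningSums k u n)]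
    (hX : topologicalKrullDim (toricVariety k u) = n) :
    ∃ e : ProjectiveEquivalence (gaussImage (toricVariety k u) hX)
        (toricVarietyOfSet k (spanningSums k u n)),
      ∀ (b₀ : spanningSums k u n) (t : Torus k M),
        Projectivization.map e.left e.left_injective (plucker (gaussMap (toricVariety k u) hX
            ⟨torusMap k u t, torusMap_mem_smoothLocus hu t⟩)) =
          Projectivization.map e.right e.right_injective (orbitMap k (spanningSums k u n) b₀
            (Torus.induced k (diffLattice (spanningSums k u n)).subtype t)) := by
  obtain ⟨R, hR, hRφ⟩ := exists_linearMap_plucker_gaussMap_torusMap (k := k) hu hn hX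
  have := (finite_spanningSums (k := k) (n := n) u).to_subtype
  have himage : gaussImage (toricVariety k u) hX =
      Projectivization.map R hR '' toricVarietyOfSet k (spanningSums k u n) := by
    rw [gaussImage_eq_closure_range hX (torusMap_mem_smoothLocus hu) subset_rfl, funext hRφ,
      toricVarietyOfSet, toricVariety,
      ← (isClosedEmbedding_projectivizationMap R hR).closure_image_eq, ← Set.range_comp]
    rfl
  obtain ⟨e, he⟩ := exists_projectiveEquivalence_of_map R hR himage
  exact ⟨e, fun b₀ t => by rw [hRφ, he, torusMap_eq_orbitMap _ b₀]⟩

end GaussMap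

/-! ### The torus action on projective space -/

section TorusAction

variable {k : Type*} [Field k] {L ι : Type*} [AddCommGroup L]

/-- The diagonal action of `t ∈ T_L` on `k^ι` through the characters `v_i`. -/
def diagonal (v : ι → L) (t : Torus k L) : (ι → k) ≃ₗ[k] (ι → k) :=
  LinearEquiv.piCongrRight fun i => LinearEquiv.smulOfUnit (t (Multiplicative.ofAdd (v i)))

theorem diagonal_apply (v : ι → L) (t : Torus k L) (x : ι → k) (i : ι) :
    diagonal v t x i = Torus.monomial (v i) t * x i :=
  rfl

/-- The action of `t ∈ T_L` on projective space through the characters `v_i`, for which the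
toric variety of `v` is the closure of an orbit. -/
def translate (v : ι → L) (t : Torus k L) : ℙ k (ι → k) → ℙ k (ι → k) :=
  Projectivization.map (diagonal v t).toLinearMap (diagonal v t).injective

theorem translate_mul (v : ι → L) (s t : Torus k L) (y : ℙ k (ι → k)) :
    translate v (s * t) y = translate v s (translate v t y) := by
  induction y using Projectivization.ind with | h x hx => ?_
  simp only [translate, Projectivization.map_mk]
  congr 1
  funext i
  simp only [LinearEquiv.coe_coe, diagonal_apply, Torus.monomial_mul, mul_assoc]

theorem translate_induced {L' : Type*} [AddCommGroup L'] (f : L →+ L') (v : ι → L)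
    (t : Torus k L') (y : ℙ k (ι → k)) :
    translate v (Torus.induced k f t) y = translate (f ∘ v) t y :=
  rfl

variable [Nonempty ι]

theorem translate_torusMap (v : ι → L) (s t : Torus k L) :
    translate v s (torusMap k v t) = torusMap k v (s * t) := by
  rw [torusMap, torusMap, translate, Projectivization.map_mk]
  simp only [Torus.monomial_mul]
  rfl

theorem image_translate_toricVariety [Finite ι] (v : ι → L) (t : Torus k L) :
    translate v t '' toricVariety k v = toricVariety k v := by
  have h := isClosedEmbedding_projectivizationMap _ (diagonal v t).injective
  have hrange : translate v t '' Set.range (torusMap k v) = Set.range (torusMap k v) := by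
    rw [← Set.range_comp]
    exact (congrArg Set.range (funext (translate_torusMap v t))).trans
      ((mul_left_surjective t).range_comp (torusMap k v))
  exact (h.closure_image_eq _).symm.trans (congrArg closure hrange)

theorem exists_translate_eq [IsAlgClosed k] {v : ι → L} {y y' : ℙ k (ι → k)}
    (hy : y ∈ toricVariety k v) (hy' : y' ∈ toricVariety k v)
    (hsupp : ∀ i, y.rep i ≠ 0 ↔ y'.rep i ≠ 0) : ∃ t : Torus k L, translate v t y = y' := by
  obtain ⟨t, ht⟩ := exists_torus_eq_rep_of_mem_toricVariety hy
  obtain ⟨t', ht'⟩ := exists_torus_eq_rep_of_mem_toricVariety hy'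
  refine ⟨Torus.induced k (AddMonoidHom.inl L ℤ) (t⁻¹ * t'), ?_⟩
  rw [← y.mk_rep, ← y'.mk_rep, translate, Projectivization.map_mk, eq_comm,
    Projectivization.mk_eq_mk_iff']
  refine ⟨Torus.monomial (0, 1) (t⁻¹ * t'), funext fun i => ?_⟩
  rw [Pi.smul_apply, smul_eq_mul, LinearEquiv.coe_coe, diagonal_apply, ← mul_assoc,
    ← monomial_homogenize, Torus.monomial_mul, Torus.monomial_inv]
  by_cases hi : y.rep i = 0
  · rw [hi, mul_zero, not_not.1 ((hsupp i).not.1 (not_not.2 hi))]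
  · rw [ht i hi, ht' i ((hsupp i).1 hi), mul_right_comm, inv_mul_cancel₀ hi, one_mul]

end TorusAction

section OrbitClosure

variable {k : Type*} [Field k] {L ι : Type*} [AddCommGroup L]

instance nonempty_support (y : ℙ k (ι → k)) : Nonempty {i // y.rep i ≠ 0} :=
  nonempty_subtype.2 (Function.ne_iff.1 y.rep_nonzero)

/-- The linear embedding of the coordinate subspace spanned by the support of `y`, scaled so that
`[1 : ⋯ : 1]` goes to `y`. The map `Function.invFun Subtype.val` is an arbitrary retraction onto
the support: off the support the weight is zero. -/
def supportEmbedding (y : ℙ k (ι → k)) : ({i // y.rep i ≠ 0} → k) →ₗ[k] (ι → k) :=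
  weightedPullback y.rep (Function.invFun Subtype.val)

theorem invFun_val_weight (y : ℙ k (ι → k)) (j : {i // y.rep i ≠ 0}) :
    ∃ i, Function.invFun Subtype.val i = j ∧ y.rep i ≠ 0 :=
  ⟨j, Function.leftInverse_invFun Subtype.val_injective j, j.2⟩

theorem supportEmbedding_injective (y : ℙ k (ι → k)) :
    Function.Injective (supportEmbedding y) :=
  weightedPullback_injective (invFun_val_weight y)

theorem translate_eq_map_supportEmbedding (v : ι → L) (t : Torus k L) (y : ℙ k (ι → k)) :
    translate v t y = Projectivization.map (supportEmbedding y) (supportEmbedding_injective y)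
      (torusMap k (fun i : {i // y.rep i ≠ 0} => v i) t) := by
  conv_lhs => rw [← y.mk_rep]
  refine (map_weightedPullback_torusMap (invFun_val_weight y) _ t _ fun i => ?_).symm
  rw [LinearEquiv.coe_coe, diagonal_apply, mul_comm]
  by_cases hi : y.rep i = 0
  · simp only [hi, zero_mul]
  · rw [Function.leftInverse_invFun Subtype.val_injective ⟨i, hi⟩]

end OrbitClosure

/-! ### The fibers of the Gauss map -/

section TorusCoset

variable {k : Type*} [Field k] {L L' ι : Type*} [AddCommGroup L] [AddCommGroup L'] [Nonempty ι]

theorem isInducing_torusMap_mul_induced [Finite ι] {v : ι → L}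
    (hv : affineSpan ℤ (Set.range v) = ⊤) {f : L →+ L'} (hf : Function.Surjective f)
    (s : Torus k L) :
    Topology.IsInducing fun t => torusMap k v (s * Torus.induced k f t) := by
  have hfv : affineSpan ℤ (Set.range (f ∘ v)) = ⊤ := by
    rw [Set.range_comp]
    exact AffineMap.span_eq_top_of_surjective f.toIntLinearMap.toAffineMap hf hv
  have h : (fun t => torusMap k v (s * Torus.induced k f t)) =
      translate v s ∘ torusMap k (f ∘ v) :=
    funext fun t => (translate_torusMap v s _).symm
  rw [h]
  exact (isClosedEmbedding_projectivizationMap _ (diagonal v s).injective).isInducing.comp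
    (isEmbedding_torusMap hfv).isInducing

theorem projectivelyEquivalent_closure_image_mul_induced [Finite ι] (v : ι → L) (f : L →+ L')
    (s : Torus k L) :
    ProjectivelyEquivalent
      (closure (torusMap k v '' ((s * ·) '' Set.range (Torus.induced k f))))
      (toricVarietyOfSet k (Set.range fun i => f (v i))) := by
  let S : Set L' := Set.range fun i => f (v i)
  let σ : ι → S := fun i => ⟨f (v i), i, rfl⟩
  have hσ : ∀ j, ∃ i, σ i = j ∧ Torus.monomial (v i) s ≠ 0 := by
    rintro ⟨_, i, rfl⟩
    exact ⟨i, rfl, Torus.monomial_ne_zero _ _⟩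
  let R : (S → k) →ₗ[k] (ι → k) := weightedPullback (fun i => Torus.monomial (v i) s) σ
  have hR : Function.Injective R := weightedPullback_injective hσ
  have hmap : ∀ t, torusMap k v (s * Torus.induced k f t) =
      Projectivization.map R hR (torusMap k (Subtype.val : S → L') t) := fun t =>
    (map_weightedPullback_torusMap hσ _ t _ fun i => Torus.monomial_mul _ _ _).symm
  refine ⟨(exists_projectiveEquivalence_of_map R hR ?_).choose⟩
  rw [toricVarietyOfSet, toricVariety,
    ← (isClosedEmbedding_projectivizationMap R hR).closure_image_eq, ← Set.range_comp,
    ← Set.range_comp, ← Set.range_comp]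
  exact congrArg closure (congrArg Set.range (funext hmap))

end TorusCoset

section Fibers

variable {k : Type*} [Field k] {M : Type*} [AddCommGroup M] {n N : ℕ} {u : Fin (N + 1) → M}

theorem embeddedTangentSpace_translate (t : Torus k M) (y : ℙ k (Fin (N + 1) → k)) :
    embeddedTangentSpace (toricVariety k u) (translate u t y) =
      (embeddedTangentSpace (toricVariety k u) y).map (diagonal u t).toLinearMap := by
  rw [← embeddedTangentSpace_map]
  exact congrArg (embeddedTangentSpace · _) (image_translate_toricVariety u t).symm

variable [Module.Free ℤ M] [Module.Finite ℤ M] (hu : affineSpan ℤ (Set.range u) = ⊤)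
  (hn : Module.finrank ℤ M = n)
include hu hn

theorem exists_image_val_eq_of_mem_irreducibleComponents_gaussMap [Infinite k]
    (hX : topologicalKrullDim (toricVariety k u) = n) (W : Grassmannian k n N)
    {C : Set {t : Torus k M // gaussMap (toricVariety k u) hX
      ⟨torusMap k u t, torusMap_mem_smoothLocus hu t⟩ = W}}
    (hC : C ∈ irreducibleComponents {t : Torus k M // gaussMap (toricVariety k u) hX
      ⟨torusMap k u t, torusMap_mem_smoothLocus hu t⟩ = W}) :
    ∃ s : Torus k M, Subtype.val '' C = (s * ·) '' Set.range (Torus.induced k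
      (QuotientAddGroup.mk' (realSaturation (spanningSums k u n)))) := by
  obtain ⟨⟨s, rfl⟩, -⟩ := hC.1.1
  have := isTorsionFree_quotient_realSaturation (spanningSums k u n)
  obtain ⟨R, hRfin, hR⟩ := exists_finite_cosets (spanningSums k u n) s
  have hfiber := (Set.ext fun t => gaussMap_torusMap_eq_iff hu hn hX t s).trans hR
  obtain ⟨r, -, hr⟩ := exists_image_val_eq_of_mem_irreducibleComponents hRfin
    (fun r _ => isClosed_setOf_monomial_eq _ r) (fun r _ => isIrreducible_setOf_monomial_eq r)
    hfiber hC
  exact ⟨r, hr.trans (mul_image_range_induced_mk' _ r).symm⟩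

theorem monomial_eq_one_of_embeddedTangentSpace_translate_eq [Infinite k] {s t : Torus k M}
    {y : ℙ k (Fin (N + 1) → k)}
    (hy : embeddedTangentSpace (toricVariety k u) y =
      embeddedTangentSpace (toricVariety k u) (torusMap k u s))
    (hty : embeddedTangentSpace (toricVariety k u) (translate u t y) =
      embeddedTangentSpace (toricVariety k u) (torusMap k u s))
    {m : M} (hm : m ∈ diffLattice (spanningSums k u n)) : Torus.monomial m t = 1 := by
  have hts : embeddedTangentSpace (toricVariety k u) (torusMap k u (t * s)) =
      embeddedTangentSpace (toricVariety k u) (torusMap k u s) := by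
    rw [← translate_torusMap, embeddedTangentSpace_translate, ← hy,
      ← embeddedTangentSpace_translate, hty, hy]
  have hX : topologicalKrullDim (toricVariety k u) = n := hn ▸ topologicalKrullDim_toricVariety hu
  have h := (gaussMap_torusMap_eq_iff hu hn hX (t * s) s).1 (Subtype.ext hts) m hm
  rwa [Torus.monomial_mul, mul_eq_right₀ (Torus.monomial_ne_zero m s)] at h

theorem exists_finite_translate_eq [IsAlgClosed k] (s : Torus k M) :
    ∃ R : Set (Torus k M), R.Finite ∧ ∀ y ∈ toricVariety k u, ∀ y' ∈ toricVariety k u,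
      embeddedTangentSpace (toricVariety k u) y =
        embeddedTangentSpace (toricVariety k u) (torusMap k u s) →
      embeddedTangentSpace (toricVariety k u) y' =
        embeddedTangentSpace (toricVariety k u) (torusMap k u s) →
      (∀ i, y.rep i ≠ 0 ↔ y'.rep i ≠ 0) →
      ∃ r ∈ R, ∃ t, translate (QuotientAddGroup.mk' (realSaturation (spanningSums k u n)) ∘ u) t
        (translate u r y) = y' := by
  have : Infinite k := IsAlgClosed.instInfinite
  obtain ⟨R, hRfin, hR⟩ := exists_finite_cosets (spanningSums k u n) (1 : Torus k M)
  refine ⟨R, hRfin, fun y hy y' hy' hT hT' hsupp => ?_⟩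
  obtain ⟨τ, rfl⟩ := exists_translate_eq hy hy' hsupp
  have hτ : ∀ m ∈ diffLattice (spanningSums k u n), Torus.monomial m τ = Torus.monomial m 1 :=
    fun m hm => (monomial_eq_one_of_embeddedTangentSpace_translate_eq hu hn hT hT' hm).trans
      (Torus.monomial_one m).symm
  obtain ⟨r, hr, hτr⟩ := Set.mem_iUnion₂.1 (hR.subset hτ)
  obtain ⟨_, ⟨t, rfl⟩, rfl⟩ := (mul_image_range_induced_mk' _ r).superset hτr
  refine ⟨r, hr, t, ?_⟩
  rw [← translate_induced, ← translate_mul]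
  exact congrArg (translate u · y) (mul_comm (Torus.induced k _ t) r)

theorem topologicalKrullDim_gaussMap_fiber_le [IsAlgClosed k]
    (hX : topologicalKrullDim (toricVariety k u) = n) (s : Torus k M) :
    topologicalKrullDim {y : smoothLocus (toricVariety k u) | gaussMap (toricVariety k u) hX y =
      gaussMap (toricVariety k u) hX ⟨torusMap k u s, torusMap_mem_smoothLocus hu s⟩} ≤
        Module.finrank ℤ (M ⧸ realSaturation (spanningSums k u n)) := by
  have : Infinite k := IsAlgClosed.instInfinite
  have := isTorsionFree_quotient_realSaturation (spanningSums k u n)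
  have := finite_quotient (realSaturation (spanningSums k u n))
  let F := {y : smoothLocus (toricVariety k u) | gaussMap (toricVariety k u) hX y =
      gaussMap (toricVariety k u) hX ⟨torusMap k u s, torusMap_mem_smoothLocus hu s⟩}
  let supp : F → Set (Fin (N + 1)) := fun y => {i | y.1.1.rep i ≠ 0}
  obtain ⟨R, hRfin, hR⟩ := exists_finite_translate_eq (k := k) hu hn s
  have := hRfin.to_subtype
  -- The fiber meets each coordinate torus in finitely many orbits of the subtorus.
  let base : Set.range supp × R → ℙ k (Fin (N + 1) → k) := fun p =>
    translate u p.2.1 (Set.rangeSplitting supp p.1).1.1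
  refine topologicalKrullDim_le_of_isInducing
    (Topology.IsInducing.subtypeVal.comp Topology.IsInducing.subtypeVal : Topology.IsInducing
      fun y : F => y.1.1)
    (fun p (i : {i // (base p).rep i ≠ 0}) =>
      QuotientAddGroup.mk' (realSaturation (spanningSums k u n)) (u i))
    (R := fun p => supportEmbedding (base p)) (fun p => supportEmbedding_injective (base p))
    fun y => ?_
  let y₀ := Set.rangeSplitting supp ⟨supp y, y, rfl⟩
  have hsupp : supp y₀ = supp y := Set.apply_rangeSplitting supp ⟨supp y, y, rfl⟩
  obtain ⟨r, hr, t, ht⟩ := hR _ y₀.1.2.1 _ y.1.2.1 (congrArg Subtype.val y₀.2)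
    (congrArg Subtype.val y.2) (Set.ext_iff.1 hsupp)
  exact ⟨(⟨supp y, y, rfl⟩, ⟨r, hr⟩), _, subset_closure ⟨t, rfl⟩,
    (translate_eq_map_supportEmbedding _ t _).symm.trans ht⟩

theorem le_topologicalKrullDim_gaussMap_fiber [Infinite k]
    (hX : topologicalKrullDim (toricVariety k u) = n) (s : Torus k M) :
    Module.finrank ℤ (M ⧸ realSaturation (spanningSums k u n)) ≤
      topologicalKrullDim {y : smoothLocus (toricVariety k u) |
        gaussMap (toricVariety k u) hX y =
          gaussMap (toricVariety k u) hX ⟨torusMap k u s, torusMap_mem_smoothLocus hu s⟩} := by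
  have := isTorsionFree_quotient_realSaturation (spanningSums k u n)
  have := finite_quotient (realSaturation (spanningSums k u n))
  have h := isInducing_torusMap_mul_induced (k := k) hu
    (QuotientAddGroup.mk'_surjective (realSaturation (spanningSums k u n))) s
  have hmem : ∀ t, gaussMap (toricVariety k u) hX ⟨_, torusMap_mem_smoothLocus hu
      (s * Torus.induced k (QuotientAddGroup.mk' (realSaturation (spanningSums k u n))) t)⟩ =
      gaussMap (toricVariety k u) hX ⟨_, torusMap_mem_smoothLocus hu s⟩ := fun t =>
    (gaussMap_torusMap_eq_iff hu hn hX _ s).2 fun m hm =>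
      (mul_image_range_induced_mk' _ s).subset ⟨_, ⟨t, rfl⟩, rfl⟩ m
        (diffLattice_le_realSaturation _ hm)
  exact finrank_le_topologicalKrullDim_torus.trans
    ((h.codRestrict fun _ => torusMap_mem_smoothLocus hu _).codRestrict
      hmem).topologicalKrullDim_le

theorem isGaussDefect_toricVariety [IsAlgClosed k]
    (hX : topologicalKrullDim (toricVariety k u) = n) :
    IsGaussDefect (toricVariety k u) hX
      (Module.finrank ℤ (M ⧸ realSaturation (spanningSums k u n))) := by
  have : Infinite k := IsAlgClosed.instInfinite
  refine ⟨{x | ∀ i, x.rep i ≠ 0}, isOpen_forall_rep_ne_zero, ?_, ?_⟩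
  · exact closure_mono (range_torusMap u).subset
  · rw [← range_torusMap]
    rintro _ ⟨s, rfl⟩
    exact ⟨torusMap_mem_smoothLocus hu s,
      (topologicalKrullDim_gaussMap_fiber_le hu hn hX s).antisymm
        (le_topologicalKrullDim_gaussMap_fiber hu hn hX s)⟩

end Fibers

end

end ToricGauss

theorem theorem1p1 {k : Type*} [Field k] [IsAlgClosed k]
    {M : Type*} [AddCommGroup M] [Module.Free ℤ M] [Module.Finite ℤ M]
    (n : ℕ) (hn : Module.finrank ℤ M = n)
    {N : ℕ} (u : Fin (N + 1) → M) (hu : Function.Injective u)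
    (hspan : affineSpan ℤ (Set.range u) = ⊤) :
    let X : Set (ℙ k (Fin (N + 1) → k)) := toricVariety k u
    let φ : Torus k M → ℙ k (Fin (N + 1) → k) := torusMap k u
    let B : Set M := spanningSums k u n
    let π : M →+ M ⧸ realSaturation B := QuotientAddGroup.mk' (realSaturation B)
    let res : Torus k M →* Torus k (diffLattice B) := Torus.induced k (diffLattice B).subtype
    -- `X_A` has dimension `n`, contains `T_M` as a dense open subset,
    -- and the Gauss map is defined on `T_M`
    ∃ (_ : Nonempty B) (hX : topologicalKrullDim X = n) (hφ : ∀ t, φ t ∈ smoothLocus X),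
      IsDenseOpenIn φ X ∧
      -- (1) and (2): a projective equivalence of the closure of the image with `X_B`,
      -- under which the Gauss map on `T_M` is the surjection `T_M → T_{⟨B-B⟩} ⊆ X_B`
      (∃ e : ProjectiveEquivalence (gaussImage X hX) (toricVarietyOfSet k B),
        Function.Surjective res ∧
        ∀ b₀ : B, IsDenseOpenIn (orbitMap k B b₀) (toricVarietyOfSet k B) ∧
          ∀ t : Torus k M,
            Projectivization.map e.left e.left_injective (plucker (gaussMap X hX ⟨φ t, hφ t⟩)) =
              Projectivization.map e.right e.right_injective (orbitMap k B b₀ (res t))) ∧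
      -- (3): the irreducible components of the fibers of the Gauss map on `T_M`
      (∀ (W : Grassmannian k n N),
        ∀ C ∈ irreducibleComponents {t : Torus k M // gaussMap X hX ⟨φ t, hφ t⟩ = W},
          (∃ s : Torus k M,
            Subtype.val '' C = (fun t => s * t) '' Set.range (Torus.induced k π)) ∧
          ProjectivelyEquivalent (closure (φ '' (Subtype.val '' C)))
            (toricVarietyOfSet k (Set.range fun i => π (u i)))) ∧
      -- the Gauss defect
      IsGaussDefect X hX (Module.finrank ℤ (M ⧸ realSaturation B)) ∧
      (Module.finrank ℤ (M ⧸ realSaturation B) : ℤ) =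
        n - Module.finrank ℤ (diffLattice B) := by
  have : Infinite k := IsAlgClosed.instInfinite
  intro X φ B π res
  have hB : Nonempty B := (nonempty_spanningSums hspan k hn).to_subtype
  have : Finite B := (finite_spanningSums u).to_subtype
  have hX : topologicalKrullDim X = n := hn ▸ topologicalKrullDim_toricVariety hspan
  refine ⟨hB, hX, torusMap_mem_smoothLocus hspan, isDenseOpenIn_torusMap hspan, ?_, ?_,
    isGaussDefect_toricVariety hspan hn hX, ?_⟩
  · obtain ⟨e, he⟩ := exists_projectiveEquivalence_gaussImage (k := k) hspan hn hX
    exact ⟨e, induced_subtype_surjective _, fun b₀ => ⟨isDenseOpenIn_orbitMap B b₀, he b₀⟩⟩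
  · intro W C hC
    obtain ⟨s, hs⟩ :=
      exists_image_val_eq_of_mem_irreducibleComponents_gaussMap hspan hn hX W hC
    exact ⟨⟨s, hs⟩, hs ▸ projectivelyEquivalent_closure_image_mul_induced u π s⟩
  · have h := finrank_quotient_realSaturation B
    omega
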